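/- Let $\omega$ denote the exponent of matrix multiplication over $\mathbb{Q}$, i.e. the infimum of the real numbers $\tau$ such that, for every $\epsilon>0$, $n\times n$ matrices can be multiplied by algebraic (bilinear) algorithms of rank $O(n^{\tau+\epsilon})$. For a simple graph $G=(V,E)$, let $D(G)$ be the set of vertices that are missed by at least one maximum matching of $G$, let $K(G)$ be the set of vertices in $V\setminus D(G)$ that are adjacent to a vertex of $D(G)$, and let $C(G)=V\setminus(D(G)\cup K(G))$; the triple $(D(G),K(G),C(G))$ is the Gallai–Edmonds decomposition of $G$. In the congested clique model, $n$ nodes communicate in synchronous rounds; in each round each node can send to every other node a (possibly different) message of $O(\log n)$ bits; local computation is unrestricted, and each node has its own private randomness. The input is a simple graph $G$ on $n$ vertices, where initially node $\ell$ knows only the set of vertices adjacent to the $\ell$-th vertex. Theorem. The randomized round complexity of computing the Gallai–Edmonds decomposition of a simple graph with $n$ vertices in the congested clique model is $O(n^{1-1/\omega})$, where, as usual, an $o(1)$ term in the exponent is ignored. Precisely: for every $\epsilon>0$, every message-size constant $c\ge 1$ and every $k\ge 0$ there is a constant $C$ such that for every $n\ge 1$ there is a randomized protocol for $n$ nodes,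 with messages of $c\lceil\log_2 n\rceil$ bits and with at most $C\,n^{1-1/\omega+\epsilon}$ rounds, such that for every simple graph $G$ on $n$ vertices, with probability at least $1-n^{-k}$, all nodes output $(D(G),K(G),C(G))$. -/

import Mathlib

/-! ### The exponent of matrix multiplication -/

/-- There is an algebraic (bilinear) algorithm of rank `t` over the field `K` for the product of two
`n × n` matrices: coefficients `a`, `b`, `l` in `K` such that every entry of `A * B` is
`∑ μ, l i j μ * S μ * T μ`, where `S μ` and `T μ` are the linear forms in the entries of `A` and of
`B` with coefficients `a` and `b`. -/
def HasBilinearAlgorithm (K : Type) [Field K] (n t : ℕ) : Prop :=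
  ∃ a b l : Fin n → Fin n → Fin t → K, ∀ (A B : Matrix (Fin n) (Fin n) K) (i j : Fin n),
    (A * B) i j = ∑ μ : Fin t,
      l i j μ * (∑ i' : Fin n, ∑ j' : Fin n, a i' j' μ * A i' j') *
        (∑ i' : Fin n, ∑ j' : Fin n, b i' j' μ * B j' i')

/-- The exponent of square matrix multiplication over `K`: the infimum of the `τ` such that
`n × n` matrices can be multiplied by bilinear algorithms of rank `O(n ^ (τ + ε))`
for every `ε > 0`. -/
noncomputable def matMulExponent (K : Type) [Field K] : ℝ :=
  sInf {τ : ℝ | ∀ ε : ℝ, 0 < ε → ∃ C : ℝ, ∀ n : ℕ, 1 ≤ n →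
    ∃ t : ℕ, (t : ℝ) ≤ C * (n : ℝ) ^ (τ + ε) ∧ HasBilinearAlgorithm K n t}

/-! ### The congested clique model -/

/-- A randomized protocol for `n` fully connected nodes working in synchronous rounds, in which
every node sends in every round one message of `B` bits to each node (the messages to different
nodes may differ). Every node starts with its own input in `In` and its own private random seed, and
ends with an output in `Out`. Local computation is not restricted. -/
structure CliqueProtocol (n B : ℕ) (In Out : Type) where
  /-- the finite set from which each node draws its private random seed -/
  Seed : Type
  seedFinite : Finite Seed
  seedNonempty : Nonempty Seed
  /-- the possible local states of a node -/
  State : Type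
  /-- the number of rounds -/
  rounds : ℕ
  /-- the initial state of a node, from its input and its seed -/
  init : Fin n → In → Seed → State
  /-- `send t v s w` is the message that node `v`, in state `s`, sends to node `w` in round `t` -/
  send : ℕ → Fin n → State → Fin n → (Fin B → Bool)
  /-- `step t v s m` is the next state of node `v`, in state `s`, when in round `t` it receives the
  message `m w` from each node `w` -/
  step : ℕ → Fin n → State → (Fin n → (Fin B → Bool)) → State
  /-- the output of a node, from its final state -/
  output : Fin n → State → Out

namespace CliqueProtocol

variable {n B : ℕ} {In Out : Type}

/-- The states of all nodes after `t` rounds, on inputs `x` and seeds `r`. -/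
def stateAfter (P : CliqueProtocol n B In Out) (x : Fin n → In) (r : Fin n → P.Seed) :
    ℕ → Fin n → P.State
  | 0 => fun v => P.init v (x v) (r v)
  | t + 1 => fun v =>
      P.step t v (P.stateAfter x r t v) (fun w => P.send t w (P.stateAfter x r t w) v)

/-- The outputs of all nodes after the last round, on inputs `x` and seeds `r`. -/
def run (P : CliqueProtocol n B In Out) (x : Fin n → In) (r : Fin n → P.Seed) : Fin n → Out :=
  fun v => P.output v (P.stateAfter x r P.rounds v)

/-- The probability, over independent uniformly random seeds of the nodes, that the outputs of the
nodes on inputs `x` satisfy `good`. -/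
noncomputable def successProb (P : CliqueProtocol n B In Out) (x : Fin n → In)
    (good : (Fin n → Out) → Prop) : ℝ :=
  (Nat.card {r : Fin n → P.Seed // good (P.run x r)} : ℝ) / (Nat.card (Fin n → P.Seed) : ℝ)

end CliqueProtocol

/-! ### The Gallai–Edmonds decomposition -/

namespace SimpleGraph

variable {V : Type}

/-- A matching with the largest number of edges. -/
def IsMaximumMatching (G : SimpleGraph V) (M : G.Subgraph) : Prop :=
  M.IsMatching ∧ ∀ M' : G.Subgraph, M'.IsMatching → M'.edgeSet.ncard ≤ M.edgeSet.ncard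

/-- `D(G)`: the non-critical vertices, i.e. those missed by some maximum matching. -/
def gallaiEdmondsD (G : SimpleGraph V) : Set V :=
  {v | ∃ M : G.Subgraph, G.IsMaximumMatching M ∧ v ∉ M.verts}

/-- `K(G)`: the vertices outside `D(G)` with a neighbour in `D(G)`. -/
def gallaiEdmondsK (G : SimpleGraph V) : Set V :=
  {v | v ∉ G.gallaiEdmondsD ∧ ∃ w ∈ G.gallaiEdmondsD, G.Adj v w}

/-- `C(G)`: the remaining vertices. -/
def gallaiEdmondsC (G : SimpleGraph V) : Set V :=
  (G.gallaiEdmondsD ∪ G.gallaiEdmondsK)ᶜ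

/-- The Gallai–Edmonds decomposition `(D(G), K(G), C(G))`. -/
def gallaiEdmonds (G : SimpleGraph V) : Set V × Set V × Set V :=
  (G.gallaiEdmondsD, G.gallaiEdmondsK, G.gallaiEdmondsC)

end SimpleGraph


/-!
A vertex `v` lies in `D(G)` exactly if deleting it does not decrease the maximum number of vertices
covered by a matching. For a generic Tutte matrix `A` of `G`, these two numbers are the degrees of
the reverse characteristic polynomials of `A` and of `A` with row and column `v` removed, and the
quotient of these polynomials is the generating series of the entries `(A ^ m) v v`. So
whether `v ∈ D(G)` can be read off from `(A ^ m) v v` for `m ≤ 2 n`; random entries of `A` in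
a field with polynomially many elements are generic enough with high probability.

Since `A` is alternating, these entries only need rows of the powers `A ^ i` and `(A ^ q) ^ j` with
`i, j ≤ q ≈ √n`, which come from `O(log n)` batches of about `√n` matrix products. A bilinear
algorithm of rank `t ≈ √n` for blocks turns such a batch into block products that are spread over
the nodes, in about `n ^ (1 - 1 / ω)` rounds.
-/

/-! ### Knowledge of the nodes -/

section Knows

variable {Ω α β : Type*} {S T : Setoid Ω} {f : Ω → α}

/-- Whoever can distinguish scenarios only up to `S` can compute `f`. -/
def Knows (S : Setoid Ω) (f : Ω → α) : Prop :=
  ∀ ω ω', S ω ω' → f ω = f ω'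

theorem knows_ker (f : Ω → α) : Knows (Setoid.ker f) f := fun _ _ h => h

theorem Knows.mono (h : Knows S f) (hTS : T ≤ S) : Knows T f :=
  fun ω ω' hT => h ω ω' (hTS hT)

theorem Knows.comp (h : Knows S f) (φ : α → β) : Knows S fun ω => φ (f ω) :=
  fun ω ω' hS => congrArg φ (h ω ω' hS)

theorem Knows.const (a : α) : Knows S fun _ => a :=
  fun _ _ _ => rfl

theorem Knows.pi {ι : Type*} {f : ι → Ω → α} (h : ∀ i, Knows S (f i)) :
    Knows S fun ω i => f i ω :=
  fun ω ω' hS => funext fun i => h i ω ω' hS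

theorem Knows.prodMk {g : Ω → β} (hf : Knows S f) (hg : Knows S g) :
    Knows S fun ω => (f ω, g ω) :=
  fun ω ω' hS => Prod.ext (hf ω ω' hS) (hg ω ω' hS)

/-- The value of `f` on a nonempty set on which it is constant (a junk value on other sets). -/
noncomputable def commonValue [Nonempty α] (f : Ω → α) (s : Set Ω) : α :=
  Classical.epsilon fun a => ∃ ω ∈ s, f ω = a

theorem Knows.commonValue_eq [Nonempty α] (h : Knows S f) (ω : Ω) :
    commonValue f {ω' | S ω ω'} = f ω := by
  obtain ⟨ω', hω', heq⟩ :=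
    Classical.epsilon_spec (p := fun a => ∃ ω' ∈ {ω' | S ω ω'}, f ω' = a) ⟨f ω, ω, S.refl ω, rfl⟩
  exact heq.symm.trans (h ω ω' hω').symm

end Knows

section Evolves

variable {n B : ℕ} {Ω : Type}

/-- The knowledge of the nodes after a round in which `v` sends `M v w` to `w`, where `K v` and
`afterRound K M v` are the relations of being indistinguishable to `v` before and after it. -/
def afterRound (K : Fin n → Setoid Ω) (M : Fin n → Fin n → Ω → (Fin B → Bool)) :
    Fin n → Setoid Ω :=
  fun v => K v ⊓ Setoid.ker fun ω w => M w v ω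

theorem knows_afterRound (K : Fin n → Setoid Ω) (M : Fin n → Fin n → Ω → (Fin B → Bool))
    (v w : Fin n) : Knows (afterRound K M w) (M v w) :=
  ((knows_ker fun ω u => M u w ω).comp fun m => m v).mono inf_le_right

/-- `Evolves B R K K'`: in `R` rounds with messages of `B` bits, the knowledge of the nodes can grow
from `K` to `K'`. -/
inductive Evolves (B : ℕ) : ℕ → (Fin n → Setoid Ω) → (Fin n → Setoid Ω) → Prop
  | refl (K : Fin n → Setoid Ω) : Evolves B 0 K K
  | round {R : ℕ} {K K' : Fin n → Setoid Ω} (h : Evolves B R K K')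
      (M : Fin n → Fin n → Ω → (Fin B → Bool)) (hM : ∀ v w, Knows (K' v) (M v w)) :
      Evolves B (R + 1) K (afterRound K' M)

/-- The knowledge of the nodes after some rounds, if `M t v w` is the message that `v` sends to `w`
in round `t`. -/
def knowledge (K : Fin n → Setoid Ω) (M : ℕ → Fin n → Fin n → Ω → (Fin B → Bool)) :
    ℕ → Fin n → Setoid Ω
  | 0 => K
  | t + 1 => afterRound (knowledge K M t) (M t)

theorem knowledge_congr {K : Fin n → Setoid Ω} {M M' : ℕ → Fin n → Fin n → Ω → (Fin B → Bool)}
    {t : ℕ} (h : ∀ s < t, M s = M' s) : knowledge K M t = knowledge K M' t := by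
  induction t with
  | zero => rfl
  | succ t ih => simp only [knowledge, ih fun s hs => h s (by omega), h t (by omega)]

namespace Evolves

variable {K K₁ K₂ : Fin n → Setoid Ω}

theorem le {R : ℕ} (h : Evolves B R K K₁) (v : Fin n) : K₁ v ≤ K v := by
  induction h with
  | refl => exact le_rfl
  | round _ _ _ ih => exact inf_le_left.trans ih

theorem trans {R R' : ℕ} (h : Evolves B R K K₁) (h' : Evolves B R' K₁ K₂) :
    Evolves B (R + R') K K₂ := by
  induction h' with
  | refl => exact h
  | round _ M hM ih => exact (ih h).round M hM

theorem exists_schedule {R : ℕ} (h : Evolves B R K K₁) :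
    ∃ M : ℕ → Fin n → Fin n → Ω → (Fin B → Bool),
      (∀ t < R, ∀ v w, Knows (knowledge K M t v) (M t v w)) ∧ knowledge K M R = K₁ := by
  induction h with
  | refl => exact ⟨fun _ _ _ _ _ => false, by simp, rfl⟩
  | @round R K K' _ M hM ih =>
    obtain ⟨M₀, hM₀, hK⟩ := ih
    have hcongr : ∀ t ≤ R, knowledge K (Function.update M₀ R M) t = knowledge K M₀ t :=
      fun t ht => knowledge_congr fun s hs => Function.update_of_ne (by omega) _ _
    refine ⟨Function.update M₀ R M, fun t ht v w => ?_, ?_⟩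
    · rw [hcongr t (by omega)]
      rcases Nat.lt_succ_iff_lt_or_eq.mp ht with h | rfl
      · rw [Function.update_of_ne (by omega)]
        exact hM₀ t h v w
      · rw [Function.update_self, hK]
        exact hM v w
    · simp only [knowledge, hcongr R le_rfl, hK, Function.update_self]

end Evolves

end Evolves

/-! ### Protocols from knowledge -/

section Protocol

variable {n B : ℕ} {In Out Seed Γ : Type} [Finite Seed] [Nonempty Seed] [Nonempty Out]

/-- What node `v` knows before the first round, namely its input and its private seed; a scenario
consists of a global input and the seeds of all nodes. -/
def initialKnowledge (Seed : Type) (input : Γ → Fin n → In) (v : Fin n) :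
    Setoid (Γ × (Fin n → Seed)) :=
  Setoid.ker fun ω => (input ω.1 v, ω.2 v)

/-- The protocol with messages `M` in which the state of a node is the set of the scenarios that
are consistent with all that it has seen. -/
noncomputable def consistencyProtocol (R : ℕ) (input : Γ → Fin n → In)
    (M : ℕ → Fin n → Fin n → Γ × (Fin n → Seed) → (Fin B → Bool))
    (out : Fin n → Γ × (Fin n → Seed) → Out) : CliqueProtocol n B In Out where
  Seed := Seed
  seedFinite := inferInstance
  seedNonempty := inferInstance
  State := Set (Γ × (Fin n → Seed))
  rounds := R
  init v x r := {ω | input ω.1 v = x ∧ ω.2 v = r}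
  send t v s w := commonValue (M t v w) s
  step t v s m := {ω | ω ∈ s ∧ ∀ w, M t w v ω = m w}
  output v s := commonValue (out v) s

variable {R : ℕ} {input : Γ → Fin n → In}
  {M : ℕ → Fin n → Fin n → Γ × (Fin n → Seed) → (Fin B → Bool)}
  {out : Fin n → Γ × (Fin n → Seed) → Out}

theorem stateAfter_consistencyProtocol
    (hM : ∀ t < R, ∀ v w, Knows (knowledge (initialKnowledge Seed input) M t v) (M t v w))
    (g : Γ) (r : Fin n → Seed) {t : ℕ} (ht : t ≤ R) (v : Fin n) :
    (consistencyProtocol R input M out).stateAfter (input g) r t v =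
      {ω | knowledge (initialKnowledge Seed input) M t v (g, r) ω} := by
  induction t generalizing v with
  | zero =>
    refine Set.ext fun ω => ?_
    change input ω.1 v = input g v ∧ ω.2 v = r v ↔ (input g v, r v) = (input ω.1 v, ω.2 v)
    rw [Prod.mk.injEq, eq_comm, @eq_comm _ (ω.2 v)]
  | succ t ih =>
    have hsend : ∀ w, (consistencyProtocol R input M out).send t w
        ((consistencyProtocol R input M out).stateAfter (input g) r t w) v = M t w v (g, r) := by
      intro w
      rw [ih (by omega) w]
      exact (hM t ht w v).commonValue_eq (g, r)
    refine Set.ext fun ω => ?_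
    simp only [CliqueProtocol.stateAfter, hsend, ih (Nat.le_of_succ_le ht) v]
    change (_ ∧ ∀ w, M t w v ω = M t w v (g, r)) ↔
      (_ ∧ (fun w => M t w v (g, r)) = fun w => M t w v ω)
    rw [funext_iff]
    exact and_congr_right fun _ => forall_congr' fun w => eq_comm

theorem run_consistencyProtocol
    (hM : ∀ t < R, ∀ v w, Knows (knowledge (initialKnowledge Seed input) M t v) (M t v w))
    (hout : ∀ v, Knows (knowledge (initialKnowledge Seed input) M R v) (out v))
    (g : Γ) (r : Fin n → Seed) :
    (consistencyProtocol R input M out).run (input g) r = fun v => out v (g, r) := by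
  funext v
  change commonValue (out v) ((consistencyProtocol R input M out).stateAfter (input g) r R v) = _
  rw [stateAfter_consistencyProtocol hM g r le_rfl]
  exact (hout v).commonValue_eq (g, r)

theorem Evolves.exists_protocol {K : Fin n → Setoid (Γ × (Fin n → Seed))}
    (h : Evolves B R (initialKnowledge Seed input) K) (hout : ∀ v, Knows (K v) (out v)) :
    ∃ P : CliqueProtocol n B In Out, P.rounds = R ∧
      ∀ (g : Γ) (good : (Fin n → Out) → Prop), P.successProb (input g) good =
        (Nat.card {r : Fin n → Seed // good fun v => out v (g, r)} : ℝ) /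
          (Nat.card (Fin n → Seed) : ℝ) := by
  obtain ⟨M, hM, rfl⟩ := h.exists_schedule
  refine ⟨consistencyProtocol R input M out, rfl, fun g good => ?_⟩
  change (Nat.card {r : Fin n → Seed //
    good ((consistencyProtocol R input M out).run (input g) r)} : ℝ) /
      (Nat.card (Fin n → Seed) : ℝ) = _
  simp only [run_consistencyProtocol hM hout]

end Protocol

/-! ### Oblivious routing -/

section FiberBound

variable {J J' U W : Type*}

/-- Every fibre of `f` has at most `c` elements, expressed by labels from `Fin c` that tell the
elements of each fibre apart. -/
def FiberBound (f : J → U) (c : ℕ) : Prop :=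
  ∃ label : J → Fin c, Function.Injective fun j => (f j, label j)

namespace FiberBound

variable {f : J → U} {c d : ℕ}

theorem of_injective {P : Type*} [Fintype P] (label : J → P)
    (h : Function.Injective fun j => (f j, label j)) (hc : Fintype.card P ≤ c) :
    FiberBound f c := by
  obtain ⟨e⟩ : Nonempty (P ↪ Fin c) := Function.Embedding.nonempty_of_card_le (by simpa using hc)
  exact ⟨fun j => e (label j), fun j j' hj => h (Prod.ext (Prod.ext_iff.mp hj).1
    (e.injective (Prod.ext_iff.mp hj).2))⟩

theorem mono (h : FiberBound f c) (hcd : c ≤ d) : FiberBound f d := by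
  obtain ⟨label, hlabel⟩ := h
  exact of_injective label hlabel (by simpa using hcd)

theorem comp {g : U → W} (hg : FiberBound g d) (hf : FiberBound f c) :
    FiberBound (g ∘ f) (d * c) := by
  obtain ⟨labelf, hlabelf⟩ := hf
  obtain ⟨labelg, hlabelg⟩ := hg
  refine of_injective (fun j => (labelg (f j), labelf j)) (fun j j' hj => ?_) (by simp)
  obtain ⟨hgf, hlg, hlf⟩ : g (f j) = g (f j') ∧ labelg (f j) = labelg (f j') ∧
      labelf j = labelf j' := by simpa using hj
  exact hlabelf (Prod.ext (hlabelg (Prod.ext hgf hlg)) hlf)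

theorem finite [Finite U] (h : FiberBound f c) : Finite J := by
  obtain ⟨_, hlabel⟩ := h
  exact Finite.of_injective _ hlabel

theorem card_filter_le [Fintype J] [DecidableEq U] (h : FiberBound f c) (u : U) :
    (Finset.univ.filter fun j => f j = u).card ≤ c := by
  obtain ⟨label, hlabel⟩ := h
  refine (Finset.card_le_card_of_injOn label (fun _ _ => Finset.mem_univ _)
    fun j hj j' hj' he => ?_).trans_eq (Finset.card_fin c)
  have hf : f j = f j' := (Finset.mem_filter.mp hj).2.trans (Finset.mem_filter.mp hj').2.symm
  exact hlabel (Prod.ext hf he)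

end FiberBound

theorem exists_fiberBound_of_card_le {T : Type*} [Fintype T] {n c : ℕ}
    (h : Fintype.card T ≤ n * c) : ∃ f : T → Fin n, FiberBound f c := by
  obtain ⟨e⟩ : Nonempty (T ↪ Fin n × Fin c) :=
    Function.Embedding.nonempty_of_card_le (by simpa using h)
  exact ⟨fun x => (e x).1, fun x => (e x).2, e.injective⟩

end FiberBound

theorem colorable_of_degree_lt {V : Type*} [Fintype V] (G : SimpleGraph V) [DecidableRel G.Adj]
    {N : ℕ} (hN : ∀ v, G.degree v < N) : G.Colorable N := by
  classical
  suffices hpartial : ∀ s : Finset V, ∃ c : V → Fin N, ∀ u ∈ s, ∀ v ∈ s, G.Adj u v → c u ≠ c v by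
    obtain ⟨c, hc⟩ := hpartial Finset.univ
    exact ⟨c, fun {u v} huv => hc u (Finset.mem_univ _) v (Finset.mem_univ _) huv⟩
  intro s
  induction s using Finset.induction_on with
  | empty => exact ⟨fun v => ⟨0, (Nat.zero_le _).trans_lt (hN v)⟩, by simp⟩
  | insert a s _ ih =>
    obtain ⟨c, hc⟩ := ih
    obtain ⟨x, hx⟩ : ∃ x, x ∉ (G.neighborFinset a).image c := by
      by_contra! hall
      have hcard := Finset.card_le_card fun x (_ : x ∈ Finset.univ) => hall x
      rw [Finset.card_fin] at hcard
      exact absurd (hcard.trans Finset.card_image_le) (not_le.mpr (hN a))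
    have hfree : ∀ v, G.Adj a v → c v ≠ x := fun v hv he =>
      hx (Finset.mem_image.mpr ⟨v, (G.mem_neighborFinset a v).mpr hv, he⟩)
    refine ⟨Function.update c a x, fun u hu v hv huv => ?_⟩
    by_cases hua : u = a
    · subst hua
      rw [Function.update_self, Function.update_of_ne huv.ne']
      exact (hfree v huv).symm
    · by_cases hva : v = a
      · subst hva
        rw [Function.update_self, Function.update_of_ne hua]
        exact hfree u huv.symm
      · rw [Function.update_of_ne hua, Function.update_of_ne hva]
        exact hc u (Finset.mem_of_mem_insert_of_ne hu hua) v
          (Finset.mem_of_mem_insert_of_ne hv hva) huv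

theorem exists_coloring_of_fiberBound {J U W : Type*} [Finite J] {src : J → U} {dst : J → W}
    {c : ℕ} (hsrc : FiberBound src c) (hdst : FiberBound dst c) :
    ∃ color : J → Fin (2 * c), (Function.Injective fun j => (src j, color j)) ∧
      Function.Injective fun j => (dst j, color j) := by
  classical
  have := Fintype.ofFinite J
  let G : SimpleGraph J := SimpleGraph.fromRel fun i j => src i = src j ∨ dst i = dst j
  have hadj : ∀ i j, G.Adj i j ↔ i ≠ j ∧ (src i = src j ∨ dst i = dst j) := fun i j => by
    simp only [G, SimpleGraph.fromRel_adj, @eq_comm _ (src j), @eq_comm _ (dst j), or_self]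
  have hdegree : ∀ j, G.degree j < 2 * c := by
    intro j
    have hsub : insert j (G.neighborFinset j) ⊆ (Finset.univ.filter fun i => src i = src j) ∪
        Finset.univ.filter fun i => dst i = dst j := by
      intro i hi
      simp only [Finset.mem_insert, SimpleGraph.mem_neighborFinset, hadj, Finset.mem_union,
        Finset.mem_filter_univ] at hi ⊢
      rcases hi with rfl | ⟨-, h⟩
      · exact Or.inl rfl
      · exact h.imp Eq.symm Eq.symm
    have hcard := (Finset.card_le_card hsub).trans (Finset.card_union_le _ _)
    rw [Finset.card_insert_of_notMem (by simp), SimpleGraph.card_neighborFinset_eq_degree] at hcard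
    have := hsrc.card_filter_le (src j)
    have := hdst.card_filter_le (dst j)
    omega
  obtain ⟨color⟩ := colorable_of_degree_lt G hdegree
  refine ⟨color, fun i j h => ?_, fun i j h => ?_⟩ <;>
    obtain ⟨hend, hcolor⟩ := Prod.ext_iff.mp h <;> by_contra hne
  · exact color.valid ((hadj i j).mpr ⟨hne, Or.inl hend⟩) hcolor
  · exact color.valid ((hadj i j).mpr ⟨hne, Or.inr hend⟩) hcolor

section Routing

variable {n B : ℕ} {Ω : Type} {J : Type*}

theorem exists_evolves_one (hB : 1 ≤ B) (K : Fin n → Setoid Ω) {src dst : J → Fin n}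
    (hinj : Function.Injective fun j => (src j, dst j)) {bit : J → Ω → Bool}
    (hbit : ∀ j, Knows (K (src j)) (bit j)) :
    ∃ K', Evolves B 1 K K' ∧ ∀ j, Knows (K' (dst j)) (bit j) := by
  let sent : Fin n × Fin n → Ω → Bool :=
    Function.extend (fun j => (src j, dst j)) bit fun _ _ => false
  have hsent : ∀ p : Fin n × Fin n, Knows (K p.1) (sent p) := by
    intro p
    by_cases hp : ∃ j, (src j, dst j) = p
    · obtain ⟨j, rfl⟩ := hp
      rw [show sent _ = bit j from hinj.extend_apply _ _ j]
      exact hbit j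
    · rw [show sent p = _ from Function.extend_apply' _ _ p hp]
      exact Knows.const false
  refine ⟨_, (Evolves.refl K).round (fun u w ω _ => sent (u, w) ω)
    fun u w => Knows.pi fun _ => hsent (u, w), fun j => ?_⟩
  rw [← show sent _ = bit j from hinj.extend_apply _ _ j]
  exact (knows_afterRound K _ (src j) (dst j)).comp fun m => m ⟨0, hB⟩

theorem exists_evolves_relay (hB : 1 ≤ B) (K : Fin n → Setoid Ω) {src dst via : J → Fin n}
    (hsrc : Function.Injective fun j => (src j, via j))
    (hdst : Function.Injective fun j => (dst j, via j))
    {bit : J → Ω → Bool} (hbit : ∀ j, Knows (K (src j)) (bit j)) :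
    ∃ K', Evolves B 2 K K' ∧ ∀ j, Knows (K' (dst j)) (bit j) := by
  obtain ⟨K₁, h₁, hvia⟩ := exists_evolves_one hB K hsrc hbit
  obtain ⟨K₂, h₂, hknow⟩ := exists_evolves_one hB K₁ (Prod.swap_injective.comp hdst) hvia
  exact ⟨K₂, h₁.trans h₂, hknow⟩

theorem exists_evolves_relay_batches (hB : 1 ≤ B) (K : Fin n → Setoid Ω)
    {src dst via : J → Fin n} {T : ℕ} {batch : J → Fin T}
    (hsrc : Function.Injective fun j => (src j, batch j, via j))
    (hdst : Function.Injective fun j => (dst j, batch j, via j))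
    {bit : J → Ω → Bool} (hbit : ∀ j, Knows (K (src j)) (bit j)) :
    ∃ K', Evolves B (2 * T) K K' ∧ ∀ j, Knows (K' (dst j)) (bit j) := by
  suffices hprefix : ∀ t ≤ T, ∃ K', Evolves B (2 * t) K K' ∧
      ∀ j, (batch j : ℕ) < t → Knows (K' (dst j)) (bit j) by
    obtain ⟨K', h, hknow⟩ := hprefix T le_rfl
    exact ⟨K', h, fun j => hknow j (batch j).2⟩
  intro t ht
  induction t with
  | zero => exact ⟨K, .refl K, by simp⟩
  | succ t ih =>
    obtain ⟨K₁, h₁, hknow₁⟩ := ih (by omega)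
    have hinj {f : J → Fin n} (hf : Function.Injective fun j => (f j, batch j, via j)) :
        Function.Injective fun j : {j // batch j = (⟨t, ht⟩ : Fin T)} => (f j, via j) := by
      intro j j' h
      obtain ⟨hend, hvia⟩ := Prod.ext_iff.mp h
      exact Subtype.ext (hf (Prod.ext hend (Prod.ext (j.2.trans j'.2.symm) hvia)))
    obtain ⟨K₂, h₂, hknow₂⟩ := exists_evolves_relay hB K₁ (hinj hsrc) (hinj hdst)
      fun j => (hbit j).mono (h₁.le _)
    refine ⟨K₂, h₁.trans h₂, fun j hj => ?_⟩
    rcases Nat.lt_succ_iff_lt_or_eq.mp hj with h | h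
    · exact (hknow₁ j h).mono (h₂.le _)
    · exact hknow₂ ⟨j, Fin.ext h⟩

-- A greedy colouring of the messages, with different colours at each sender and at each receiver,
-- tells each of them its batch and its relay.
theorem exists_evolves_route_bits (hB : 1 ≤ B) (K : Fin n → Setoid Ω)
    {src dst : J → Fin n} {L : ℕ} (hsrc : FiberBound src (L * n)) (hdst : FiberBound dst (L * n))
    {bit : J → Ω → Bool} (hbit : ∀ j, Knows (K (src j)) (bit j)) :
    ∃ K', Evolves B (4 * L) K K' ∧ ∀ j, Knows (K' (dst j)) (bit j) := by
  have := hsrc.finite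
  obtain ⟨color, hcsrc, hcdst⟩ := exists_coloring_of_fiberBound hsrc hdst
  let slot : Fin (2 * (L * n)) ≃ Fin (2 * L) × Fin n :=
    (finCongr (mul_assoc 2 L n).symm).trans finProdFinEquiv.symm
  have hslot {f : J → Fin n} (hf : Function.Injective fun j => (f j, color j)) :
      Function.Injective fun j => (f j, slot (color j)) :=
    (Function.injective_id.prodMap slot.injective).comp hf
  have hroute := exists_evolves_relay_batches hB K (hslot hcsrc) (hslot hcdst) hbit
  rwa [← mul_assoc] at hroute

theorem exists_evolves_route {α : Type*} [Fintype α] (hB : 1 ≤ B)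
    (K : Fin n → Setoid Ω) {src dst : J → Fin n} {L b : ℕ} (hα : Fintype.card α ≤ 2 ^ b)
    (hsrc : FiberBound src (L * n)) (hdst : FiberBound dst (L * n))
    {word : J → Ω → α} (hword : ∀ j, Knows (K (src j)) (word j)) :
    ∃ K', Evolves B (4 * (L * b)) K K' ∧ ∀ j, Knows (K' (dst j)) (word j) := by
  obtain ⟨enc⟩ : Nonempty (α ↪ (Fin b → Bool)) :=
    Function.Embedding.nonempty_of_card_le (by simpa using hα)
  have hfst : FiberBound (Prod.fst : J × Fin b → J) b :=
    ⟨Prod.snd, fun _ _ h => h⟩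
  have hbits {f : J → Fin n} (hf : FiberBound f (L * n)) :
      FiberBound (f ∘ Prod.fst : J × Fin b → Fin n) (L * b * n) :=
    (hf.comp hfst).mono (by rw [mul_right_comm])
  obtain ⟨K', h, hknow⟩ := exists_evolves_route_bits hB K (hbits hsrc) (hbits hdst)
    (bit := fun j ω => enc (word j.1 ω) j.2) fun j => (hword j.1).comp fun a => enc a j.2
  exact ⟨K', h, fun j ω ω' hω => enc.injective (funext fun i => hknow (j, i) ω ω' hω)⟩

end Routing

/-! ### Bilinear algorithms as tensor decompositions -/

section MatMulTensor

variable {F ι ι' τ τ' : Type*}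

/-- The coefficients `a`, `b`, `l` form a decomposition, with summands indexed by `τ`, of the
matrix multiplication tensor. The index pairs of `b` are in the order of the entries of the right
factor, unlike in `HasBilinearAlgorithm`. -/
def IsMatMulTensor [CommSemiring F] [DecidableEq ι] [Fintype τ] (a b l : ι → ι → τ → F) : Prop :=
  ∀ i j i' k k' j', ∑ μ, l i j μ * a i' k μ * b k' j' μ =
    if i = i' ∧ k = k' ∧ j = j' then 1 else 0

/-- The linear form with index `μ` of a bilinear algorithm, evaluated at a matrix `X` whose entries
may again be matrices. -/
def linForm {A : Type*} [CommSemiring F] [AddCommMonoid A] [Module F A] [Fintype ι]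
    (a : ι → ι → τ → F) (X : Matrix ι ι A) (μ : τ) : A :=
  ∑ q : ι × ι, a q.1 q.2 μ • X q.1 q.2

theorem linForm_apply {κ κ' A : Type*} [CommSemiring F] [AddCommMonoid A] [Module F A] [Fintype ι]
    (a : ι → ι → τ → F) (X : Matrix ι ι (Matrix κ κ' A)) (μ : τ) (x : κ) (y : κ') :
    linForm a X μ x y = linForm a (X.map fun Z => Z x y) μ := by
  simp only [linForm, Matrix.sum_apply, Matrix.smul_apply, Matrix.map_apply]

namespace IsMatMulTensor

variable [DecidableEq ι] [DecidableEq ι'] [Fintype τ] [Fintype τ']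

theorem mul_apply {A : Type*} [CommSemiring F] [Semiring A] [Algebra F A] [Fintype ι]
    {a b l : ι → ι → τ → F} (h : IsMatMulTensor a b l) (X Y : Matrix ι ι A) (i j : ι) :
    (X * Y) i j = ∑ μ, l i j μ • (linForm a X μ * linForm b Y μ) := by
  symm
  calc ∑ μ, l i j μ • (linForm a X μ * linForm b Y μ)
      = ∑ μ, ∑ q : ι × ι, ∑ q' : ι × ι,
          (l i j μ * a q.1 q.2 μ * b q'.1 q'.2 μ) • (X q.1 q.2 * Y q'.1 q'.2) := by
        simp only [linForm, Finset.sum_mul_sum, Finset.smul_sum, smul_mul_smul_comm, smul_smul,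
          mul_assoc]
    _ = ∑ q : ι × ι, ∑ q' : ι × ι,
          (∑ μ, l i j μ * a q.1 q.2 μ * b q'.1 q'.2 μ) • (X q.1 q.2 * Y q'.1 q'.2) := by
        rw [Finset.sum_comm]
        refine Finset.sum_congr rfl fun q _ => ?_
        rw [Finset.sum_comm]
        simp only [Finset.sum_smul]
    _ = (X * Y) i j := by
        simp only [h i j, ite_smul, one_smul, zero_smul, Fintype.sum_prod_type, ite_and,
          Finset.sum_ite_eq, Finset.sum_ite_irrel, Finset.sum_const_zero, Finset.mem_univ, if_true,
          Matrix.mul_apply]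

theorem prod [CommSemiring F] {a b l : ι → ι → τ → F} {a' b' l' : ι' → ι' → τ' → F}
    (h : IsMatMulTensor a b l) (h' : IsMatMulTensor a' b' l') :
    IsMatMulTensor (fun (i j : ι × ι') (μ : τ × τ') => a i.1 j.1 μ.1 * a' i.2 j.2 μ.2)
      (fun i j μ => b i.1 j.1 μ.1 * b' i.2 j.2 μ.2)
      (fun i j μ => l i.1 j.1 μ.1 * l' i.2 j.2 μ.2) := by
  intro i j i' k k' j'
  have hterm : ∀ μ : τ × τ',
      l i.1 j.1 μ.1 * l' i.2 j.2 μ.2 * (a i'.1 k.1 μ.1 * a' i'.2 k.2 μ.2) *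
        (b k'.1 j'.1 μ.1 * b' k'.2 j'.2 μ.2) =
      (l i.1 j.1 μ.1 * a i'.1 k.1 μ.1 * b k'.1 j'.1 μ.1) *
        (l' i.2 j.2 μ.2 * a' i'.2 k.2 μ.2 * b' k'.2 j'.2 μ.2) := fun μ => by ring
  simp only [hterm, Fintype.sum_prod_type]
  rw [← Finset.sum_mul_sum, h, h', ite_zero_mul_ite_zero, mul_one]
  refine if_congr ?_ rfl rfl
  simp only [Prod.ext_iff]
  tauto

theorem reindex [CommSemiring F] {a b l : ι → ι → τ → F} (h : IsMatMulTensor a b l)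
    (e : ι' ≃ ι) (f : τ' ≃ τ) :
    IsMatMulTensor (fun i j μ => a (e i) (e j) (f μ)) (fun i j μ => b (e i) (e j) (f μ))
      (fun i j μ => l (e i) (e j) (f μ)) := by
  intro i j i' k k' j'
  simpa only [e.injective.eq_iff] using (f.sum_comp fun μ =>
    l (e i) (e j) μ * a (e i') (e k) μ * b (e k') (e j') μ).trans (h _ _ _ _ _ _)

theorem sq_card_le [Field F] [Fintype ι] {a b l : ι → ι → τ → F} (h : IsMatMulTensor a b l) :
    Fintype.card ι ^ 2 ≤ Fintype.card τ := by
  have hli : LinearIndependent F fun q : ι × ι => a q.1 q.2 := by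
    rw [Fintype.linearIndependent_iff]
    intro g hg ⟨i, k⟩
    have hcoeff : ∑ q : ι × ι, g q * ∑ μ, l i i μ * a q.1 q.2 μ * b k i μ = g (i, k) := by
      simp only [h i i _ _ k i, mul_ite, mul_one, mul_zero, and_true, ite_and,
        Fintype.sum_prod_type, Finset.sum_ite_eq, Finset.sum_ite_eq', Finset.sum_ite_irrel,
        Finset.sum_const_zero, Finset.mem_univ, if_true]
    rw [← hcoeff]
    calc ∑ q : ι × ι, g q * ∑ μ, l i i μ * a q.1 q.2 μ * b k i μ
        = ∑ μ, l i i μ * b k i μ * (∑ q : ι × ι, g q • a q.1 q.2) μ := by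
          simp only [Finset.mul_sum, Finset.sum_apply, Pi.smul_apply, smul_eq_mul]
          rw [Finset.sum_comm]
          refine Finset.sum_congr rfl fun μ _ => Finset.sum_congr rfl fun q _ => ?_
          ring
      _ = 0 := by simp only [hg, Pi.zero_apply, mul_zero, Finset.sum_const_zero]
  have hcard := hli.fintype_card_le_finrank
  rwa [Fintype.card_prod, Module.finrank_fintype_fun_eq_card, ← sq] at hcard

end IsMatMulTensor

/-- The rank of the tensor of the multiplication of `m × m` matrices over `F` is at most `t`. -/
def HasMatMulTensor (F : Type*) [CommSemiring F] (m t : ℕ) : Prop :=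
  ∃ a b l : Fin m → Fin m → Fin t → F, IsMatMulTensor a b l

theorem hasMatMulTensor_iff_hasBilinearAlgorithm {K : Type} [Field K] {m t : ℕ} :
    HasMatMulTensor K m t ↔ HasBilinearAlgorithm K m t := by
  constructor
  · rintro ⟨a, b, l, h⟩
    refine ⟨a, fun j k => b k j, l, fun A B i j => ?_⟩
    rw [h.mul_apply A B i j]
    refine Finset.sum_congr rfl fun μ _ => ?_
    rw [Finset.sum_comm (f := fun j' k' => b k' j' μ * B k' j')]
    simp only [linForm, Fintype.sum_prod_type, smul_eq_mul, mul_assoc]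
  · rintro ⟨a, b, l, h⟩
    refine ⟨a, fun k j => b j k, l, fun i j i' k k' j' => ?_⟩
    have hsingle := h (Matrix.single i' k 1) (Matrix.single k' j' 1) i j
    simp only [Matrix.single_apply, mul_ite, mul_one, mul_zero, ite_and, Finset.sum_ite_eq,
      Finset.sum_ite_irrel, Finset.sum_const_zero, Finset.mem_univ, if_true] at hsingle
    rw [← hsingle]
    by_cases hk : k = k'
    · subst hk
      simp [Matrix.single_apply, ite_and, eq_comm]
    · simp [hk]

namespace HasMatMulTensor

theorem mul {F : Type*} [CommSemiring F] {m t m' t' : ℕ} (h : HasMatMulTensor F m t)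
    (h' : HasMatMulTensor F m' t') : HasMatMulTensor F (m * m') (t * t') := by
  obtain ⟨a, b, l, h⟩ := h
  obtain ⟨a', b', l', h'⟩ := h'
  exact ⟨_, _, _, (h.prod h').reindex finProdFinEquiv.symm finProdFinEquiv.symm⟩

theorem naive (F : Type*) [CommSemiring F] (m : ℕ) : HasMatMulTensor F m (m ^ 3) := by
  have htriples : IsMatMulTensor (F := F) (ι := Fin m) (τ := Fin m × Fin m × Fin m)
      (fun i k μ => if μ.1 = i ∧ μ.2.1 = k then 1 else 0)
      (fun k j μ => if μ.2.1 = k ∧ μ.2.2 = j then 1 else 0)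
      (fun i j μ => if μ.1 = i ∧ μ.2.2 = j then 1 else 0) := by
    intro i j i' k k' j'
    simp only [ite_zero_mul_ite_zero, mul_one]
    rw [Finset.sum_eq_single (i, k, j) (fun μ _ hμ => if_neg fun h => ?_) (by simp)]
    · exact if_congr (by tauto) rfl rfl
    · exact hμ (Prod.ext h.1.1.1 (Prod.ext h.1.2.2 h.1.1.2))
  have e : Fin (m ^ 3) ≃ Fin m × Fin m × Fin m :=
    Fintype.equivOfCardEq (by simp only [Fintype.card_prod, Fintype.card_fin]; ring)
  exact ⟨_, _, _, htriples.reindex (Equiv.refl _) e⟩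

theorem pow {F : Type*} [CommSemiring F] {m t : ℕ} (h : HasMatMulTensor F m t) (r : ℕ) :
    HasMatMulTensor F (m ^ r) (t ^ r) := by
  induction r with
  | zero => simpa using naive F 1
  | succ r ih => simpa only [pow_succ] using ih.mul h

theorem sq_le {F : Type*} [Field F] {m t : ℕ} (h : HasMatMulTensor F m t) : m ^ 2 ≤ t := by
  obtain ⟨a, b, l, h⟩ := h
  simpa using h.sq_card_le

end HasMatMulTensor

theorem exists_int_multiple {ι : Type*} [Finite ι] (f : ι → ℚ) :
    ∃ d : ℤ, d ≠ 0 ∧ ∃ g : ι → ℤ, ∀ i, (g i : ℚ) = d * f i := by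
  obtain ⟨d, hd⟩ := IsLocalization.exist_integer_multiples_of_finite (nonZeroDivisors ℤ) f
  choose g hg using hd
  exact ⟨d, nonZeroDivisors.coe_ne_zero d, g, fun i => by simpa [Submonoid.smul_def] using hg i⟩

theorem HasMatMulTensor.exists_int_decomposition {m t : ℕ} (h : HasMatMulTensor ℚ m t) :
    ∃ D : ℤ, D ≠ 0 ∧ ∃ a b l : Fin m → Fin m → Fin t → ℤ, ∀ i j i' k k' j',
      ∑ μ, l i j μ * a i' k μ * b k' j' μ = if i = i' ∧ k = k' ∧ j = j' then D else 0 := by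
  obtain ⟨a, b, l, h⟩ := h
  have hclear (f : Fin m → Fin m → Fin t → ℚ) : ∃ d : ℤ, d ≠ 0 ∧
      ∃ g : Fin m → Fin m → Fin t → ℤ, ∀ i j μ, (g i j μ : ℚ) = d * f i j μ := by
    obtain ⟨d, hd, g, hg⟩ := exists_int_multiple fun q : Fin m × Fin m × Fin t => f q.1 q.2.1 q.2.2
    exact ⟨d, hd, fun i j μ => g (i, j, μ), fun i j μ => hg (i, j, μ)⟩
  obtain ⟨da, hda, a', ha⟩ := hclear a
  obtain ⟨db, hdb, b', hb⟩ := hclear b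
  obtain ⟨dl, hdl, l', hl⟩ := hclear l
  refine ⟨dl * da * db, mul_ne_zero (mul_ne_zero hdl hda) hdb, a', b', l',
    fun i j i' k k' j' => ?_⟩
  rw [← Int.cast_inj (α := ℚ)]
  push_cast
  calc ∑ μ, (l' i j μ * a' i' k μ * b' k' j' μ : ℚ)
      = dl * da * db * ∑ μ, l i j μ * a i' k μ * b k' j' μ := by
        rw [Finset.mul_sum]
        refine Finset.sum_congr rfl fun μ _ => ?_
        rw [ha, hb, hl]
        ring
    _ = _ := by rw [h, mul_ite, mul_one, mul_zero]

theorem HasMatMulTensor.exists_int_forall_field {m t : ℕ} (h : HasMatMulTensor ℚ m t) :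
    ∃ D : ℤ, D ≠ 0 ∧ ∀ (F : Type) [Field F], (D : F) ≠ 0 → HasMatMulTensor F m t := by
  obtain ⟨D, hD, a, b, l, hint⟩ := h.exists_int_decomposition
  refine ⟨D, hD, fun F _ hDF => ⟨fun i j μ => a i j μ, fun i j μ => b i j μ,
    fun i j μ => (D : F)⁻¹ * l i j μ, fun i j i' k k' j' => ?_⟩⟩
  have hcast := congrArg (fun x : ℤ => (x : F)) (hint i j i' k k' j')
  simp only [Int.cast_sum, Int.cast_mul, Int.cast_ite, Int.cast_zero] at hcast
  simp only [mul_assoc] at hcast ⊢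
  rw [← Finset.mul_sum, hcast, mul_ite, inv_mul_cancel₀ hDF, mul_zero]

end MatMulTensor

/-! ### Bounds for the exponent of matrix multiplication -/

section MatMulExponent

variable (K : Type) [Field K]

theorem matMulExponent_set_nonempty :
    {τ : ℝ | ∀ ε : ℝ, 0 < ε → ∃ C : ℝ, ∀ n : ℕ, 1 ≤ n →
      ∃ t : ℕ, (t : ℝ) ≤ C * (n : ℝ) ^ (τ + ε) ∧ HasBilinearAlgorithm K n t}.Nonempty := by
  refine ⟨3, fun ε hε => ⟨1, fun n hn => ⟨n ^ 3, ?_,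
    hasMatMulTensor_iff_hasBilinearAlgorithm.mp (.naive K n)⟩⟩⟩
  have hn' : (1 : ℝ) ≤ n := by exact_mod_cast hn
  rw [one_mul, Nat.cast_pow, ← Real.rpow_natCast]
  exact Real.rpow_le_rpow_of_exponent_le hn' (by push_cast; linarith)

theorem exists_natCast_rpow_gt (C : ℝ) {δ : ℝ} (hδ : 0 < δ) (N : ℕ) :
    ∃ n : ℕ, N ≤ n ∧ C < (n : ℝ) ^ δ :=
  ((Filter.eventually_ge_atTop N).and (((tendsto_rpow_atTop hδ).comp
    tendsto_natCast_atTop_atTop).eventually_gt_atTop C)).exists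

theorem two_le_matMulExponent : 2 ≤ matMulExponent K := by
  refine le_csInf (matMulExponent_set_nonempty K) fun τ hτ => ?_
  by_contra! hlt
  obtain ⟨C, hC⟩ := hτ ((2 - τ) / 2) (by linarith)
  obtain ⟨n, hn1, hn⟩ := exists_natCast_rpow_gt C (show 0 < (2 - τ) / 2 by linarith) 1
  obtain ⟨t, ht, hbil⟩ := hC n hn1
  have hpos : (0 : ℝ) < n := by exact_mod_cast hn1
  have hsq : (n : ℝ) ^ 2 ≤ t := by
    exact_mod_cast (hasMatMulTensor_iff_hasBilinearAlgorithm.mpr hbil).sq_le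
  have hsplit : (n : ℝ) ^ 2 = (n : ℝ) ^ ((2 - τ) / 2) * (n : ℝ) ^ (τ + (2 - τ) / 2) := by
    rw [← Real.rpow_add hpos, ← Real.rpow_two]
    congr 1
    ring
  have hexceed := mul_lt_mul_of_pos_right hn (Real.rpow_pos_of_pos hpos (τ + (2 - τ) / 2))
  linarith

theorem exists_hasMatMulTensor_rank_le {δ : ℝ} (hδ : 0 < δ) :
    ∃ m t : ℕ, 2 ≤ m ∧ HasMatMulTensor K m t ∧ (t : ℝ) ≤ (m : ℝ) ^ (matMulExponent K + δ) := by
  obtain ⟨τ, hτ, hlt⟩ := exists_lt_of_csInf_lt (matMulExponent_set_nonempty K)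
    (show sInf _ < matMulExponent K + δ / 3 from lt_add_of_pos_right _ (by positivity))
  obtain ⟨C, hC⟩ := hτ (δ / 3) (by positivity)
  obtain ⟨m, hm, hCm⟩ := exists_natCast_rpow_gt C (show 0 < δ / 3 by positivity) 2
  obtain ⟨t, ht, hbil⟩ := hC m (by omega)
  refine ⟨m, t, hm, hasMatMulTensor_iff_hasBilinearAlgorithm.mpr hbil, ht.trans ?_⟩
  have hm1 : (1 : ℝ) ≤ m := by exact_mod_cast (by omega : 1 ≤ m)
  calc C * (m : ℝ) ^ (τ + δ / 3) ≤ (m : ℝ) ^ (δ / 3) * (m : ℝ) ^ (τ + δ / 3) := by gcongr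
    _ = (m : ℝ) ^ (δ / 3 + (τ + δ / 3)) := (Real.rpow_add (by linarith) _ _).symm
    _ ≤ (m : ℝ) ^ (matMulExponent K + δ) := Real.rpow_le_rpow_of_exponent_le hm1 (by linarith)

end MatMulExponent

/-! ### Products of many matrices in the congested clique -/

section Blocks

variable {F ι κ η : Type*}

/-- The matrix `X`, extended by zero along the embedding `e` of its index type into `κ × η`, as a
matrix of blocks. -/
noncomputable def blocks [Zero F] (e : ι ↪ κ × η) (X : Matrix ι ι F) :
    Matrix κ κ (Matrix η η F) :=
  fun i j x y => Function.extend (Prod.map e e) (fun p => X p.1 p.2) 0 ((i, x), (j, y))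

theorem blocks_apply [Zero F] (e : ι ↪ κ × η) (X : Matrix ι ι F) (u w : ι) :
    blocks e X (e u).1 (e w).1 (e u).2 (e w).2 = X u w :=
  (e.injective.prodMap e.injective).extend_apply (fun p => X p.1 p.2) 0 (u, w)

theorem blocks_apply_of_notMem_range [Zero F] {e : ι ↪ κ × η} (X : Matrix ι ι F) {k : κ} {y : η}
    (h : (k, y) ∉ Set.range e) (i : κ) (x : η) : blocks e X i k x y = 0 :=
  Function.extend_apply' _ _ _ fun ⟨p, hp⟩ => h ⟨p.2, (Prod.ext_iff.mp hp).2⟩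

theorem blocks_mul_blocks_apply [Fintype ι] [Fintype κ] [Fintype η] [NonUnitalNonAssocSemiring F]
    (e : ι ↪ κ × η) (X Y : Matrix ι ι F) (u w : ι) :
    (blocks e X * blocks e Y) (e u).1 (e w).1 (e u).2 (e w).2 = (X * Y) u w := by
  simp only [Matrix.mul_apply, Matrix.sum_apply]
  rw [← Fintype.sum_prod_type' fun k y =>
    blocks e X (e u).1 k (e u).2 y * blocks e Y k (e w).1 y (e w).2]
  refine (Fintype.sum_of_injective e e.injective _ _ (fun p hp => ?_) fun v => ?_).symm
  · rw [blocks_apply_of_notMem_range X hp, zero_mul]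
  · rw [blocks_apply, blocks_apply]

theorem Knows.blocks_apply [Zero F] {Ω : Type*} {S : Setoid Ω} {e : ι ↪ κ × η}
    {X : Ω → Matrix ι ι F} {x y : η}
    (h : ∀ u w, (e u).2 = x → (e w).2 = y → Knows S fun ω => X ω u w) (i j : κ) :
    Knows S fun ω => blocks e (X ω) i j x y := by
  by_cases hp : ∃ p : ι × ι, Prod.map e e p = ((i, x), (j, y))
  · obtain ⟨⟨u, w⟩, hp⟩ := hp
    obtain ⟨hu, hw⟩ := Prod.ext_iff.mp hp
    obtain ⟨rfl, rfl⟩ := Prod.ext_iff.mp hu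
    obtain ⟨rfl, rfl⟩ := Prod.ext_iff.mp hw
    simpa only [Prod.map_fst, Prod.map_snd, _root_.blocks_apply] using h u w rfl rfl
  · have hzero : ∀ ω, blocks e (X ω) i j x y = 0 := fun ω => Function.extend_apply' _ _ _ hp
    simpa only [hzero] using Knows.const 0

theorem Knows.linForm_blocks_apply [CommSemiring F] [Fintype κ] {Ω τ : Type*} {S : Setoid Ω}
    {e : ι ↪ κ × η} {X : Ω → Matrix ι ι F} {x y : η}
    (h : ∀ u w, (e u).2 = x → (e w).2 = y → Knows S fun ω => X ω u w) (a : κ → κ → τ → F) (μ : τ) :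
    Knows S fun ω => linForm a (blocks e (X ω)) μ x y := by
  simp only [linForm_apply]
  exact (Knows.pi fun q : κ × κ => Knows.blocks_apply h q.1 q.2).comp
    fun Z => ∑ q : κ × κ, a q.1 q.2 μ • Z q

theorem Knows.matrix_mul_apply [NonUnitalNonAssocSemiring F] [Fintype κ] {Ω : Type*} {S : Setoid Ω}
    {U : Ω → Matrix ι κ F} {V : Ω → Matrix κ η F} {x : ι} {z : η}
    (hU : ∀ y, Knows S fun ω => U ω x y) (hV : ∀ y, Knows S fun ω => V ω y z) :
    Knows S fun ω => (U ω * V ω) x z :=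
  (Knows.pi fun y => (hU y).prodMk (hV y)).comp fun r => ∑ y, (r y).1 * (r y).2

end Blocks

section CanMultiply

/-- In `R` rounds with messages of `B` bits, `n` nodes can multiply `q` pairs of `n × n` matrices
over `F`: if every node knows its rows of the factors, then it learns its rows of the products. -/
def CanMultiply (n B : ℕ) (F : Type*) [NonUnitalNonAssocSemiring F] (q R : ℕ) : Prop :=
  ∀ ⦃Ω : Type⦄ (K : Fin n → Setoid Ω) (X Y : Fin q → Ω → Matrix (Fin n) (Fin n) F),
    (∀ i v, Knows (K v) fun ω => X i ω v) → (∀ i v, Knows (K v) fun ω => Y i ω v) →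
      ∃ K', Evolves B R K K' ∧ ∀ i v, Knows (K' v) fun ω => (X i ω * Y i ω) v

theorem exists_evolves_mul_of_entries {F : Type*} [NonUnitalNonAssocSemiring F] [Fintype F]
    {n B b L c₁ c₂ : ℕ} {τ σ η : Type*} [Fintype τ] [Fintype σ] [Fintype η] (hB : 1 ≤ B)
    (hF : Fintype.card F ≤ 2 ^ b) {owner : τ × η × η → Fin n} (howner : FiberBound owner c₁)
    (hc₂ : Fintype.card (τ × σ) ≤ n * c₂) (hσL : c₁ * Fintype.card σ ≤ L * n)
    (hηL : c₂ * Fintype.card (η × η) ≤ L * n) {Ω : Type} (K : Fin n → Setoid Ω)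
    {S T : τ → σ → Ω → Matrix η η F}
    (hST : ∀ i μ x y, Knows (K (owner (i, x, y))) fun ω => (S i μ ω x y, T i μ ω x y)) :
    ∃ K', Evolves B (12 * (L * b)) K K' ∧
      ∀ i μ x z, Knows (K' (owner (i, x, z))) fun ω => (S i μ ω * T i μ ω) x z := by
  obtain ⟨worker, hworker⟩ := exists_fiberBound_of_card_le hc₂
  have hentry : FiberBound (fun j : τ × σ × η × η => owner (j.1, j.2.2)) (L * n) :=
    (howner.comp (.of_injective (fun j => j.2.1) (fun j j' _ => by grind) le_rfl)).mono hσL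
  have hproduct : FiberBound (fun j : τ × σ × η × η => worker (j.1, j.2.1)) (L * n) :=
    (hworker.comp (.of_injective (fun j => j.2.2) (fun j j' _ => by grind) le_rfl)).mono hηL
  have hFF : Fintype.card (F × F) ≤ 2 ^ (2 * b) := by
    rw [Fintype.card_prod, two_mul, pow_add]
    exact Nat.mul_le_mul hF hF
  obtain ⟨K₁, h₁, hentries⟩ := exists_evolves_route hB K hFF hentry hproduct
    (word := fun j ω => (S j.1 j.2.1 ω j.2.2.1 j.2.2.2, T j.1 j.2.1 ω j.2.2.1 j.2.2.2))
    fun j => hST j.1 j.2.1 j.2.2.1 j.2.2.2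
  obtain ⟨K₂, h₂, hproducts⟩ := exists_evolves_route hB K₁ hF hproduct hentry
    (word := fun j ω => (S j.1 j.2.1 ω * T j.1 j.2.1 ω) j.2.2.1 j.2.2.2)
    fun ⟨i, μ, x, z⟩ => Knows.matrix_mul_apply
      (fun y => (hentries (i, μ, x, y)).comp Prod.fst)
      fun y => (hentries (i, μ, y, z)).comp Prod.snd
  refine ⟨K₂, ?_, fun i μ x z => hproducts (i, μ, x, z)⟩
  convert h₁.trans h₂ using 1
  ring

-- The entries at a given position inside the blocks are collected at one node, which evaluates the
-- linear forms there; each product of linear forms, again a block, is computed by one node.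
theorem HasMatMulTensor.canMultiply {F : Type*} [CommSemiring F] [Fintype F]
    {n B b m t h q c₁ c₂ L : ℕ} (hT : HasMatMulTensor F m t) (hB : 1 ≤ B)
    (hF : Fintype.card F ≤ 2 ^ b) (hmh : n ≤ m * h) (hc₁ : q * h ^ 2 ≤ n * c₁)
    (hc₂ : q * t ≤ n * c₂) (hqL : q ≤ L) (hmL : c₁ * m ^ 2 ≤ L * n) (htL : c₁ * t ≤ L * n)
    (hhL : c₂ * h ^ 2 ≤ L * n) : CanMultiply n B F q (24 * (L * b)) := by
  intro Ω K X Y hX hY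
  obtain ⟨a, b', l, hT⟩ := hT
  obtain ⟨e⟩ : Nonempty (Fin n ↪ Fin m × Fin h) :=
    Function.Embedding.nonempty_of_card_le (by simpa using hmh)
  obtain ⟨owner, howner⟩ := exists_fiberBound_of_card_le (T := Fin q × Fin h × Fin h) (n := n)
    (c := c₁) (by simpa [sq] using hc₁)
  have hrow : FiberBound (fun j : Fin q × Fin n × Fin n => j.2.1) (L * n) :=
    .of_injective (fun j => (j.1, j.2.2)) (fun j j' _ => by grind)
      (by simpa using Nat.mul_le_mul_right n hqL)
  have hentry : FiberBound (fun j : Fin q × Fin n × Fin n =>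
      owner (j.1, (e j.2.1).2, (e j.2.2).2)) (L * n) :=
    (howner.comp (.of_injective (c := m ^ 2) (fun j => ((e j.2.1).1, (e j.2.2).1))
      (fun j j' _ => by grind [e.injective.eq_iff]) (by simp [sq]))).mono hmL
  have hFF : Fintype.card (F × F) ≤ 2 ^ (2 * b) := by
    rw [Fintype.card_prod, two_mul, pow_add]
    exact Nat.mul_le_mul hF hF
  obtain ⟨K₁, h₁, hentries⟩ := exists_evolves_route hB K hFF hrow hentry
    (word := fun j ω => (X j.1 ω j.2.1 j.2.2, Y j.1 ω j.2.1 j.2.2))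
    fun j => ((hX j.1 j.2.1).comp fun r => r j.2.2).prodMk ((hY j.1 j.2.1).comp fun r => r j.2.2)
  have hentries (i : Fin q) {x y : Fin h} (u w : Fin n) (hu : (e u).2 = x) (hw : (e w).2 = y) :
      Knows (K₁ (owner (i, x, y))) fun ω => (X i ω u w, Y i ω u w) := by
    subst hu hw
    exact hentries (i, u, w)
  obtain ⟨K₂, h₂, hproducts⟩ := exists_evolves_mul_of_entries (σ := Fin t) (c₂ := c₂) (L := L) hB hF
    howner (by simpa using hc₂) (by simpa using htL) (by simpa [sq] using hhL) K₁
    (S := fun i μ ω => linForm a (blocks e (X i ω)) μ)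
    (T := fun i μ ω => linForm b' (blocks e (Y i ω)) μ)
    fun i μ x y =>
      (Knows.linForm_blocks_apply
        (fun u w hu hw => (hentries i u w hu hw).comp Prod.fst) a μ).prodMk
      (Knows.linForm_blocks_apply (fun u w hu hw => (hentries i u w hu hw).comp Prod.snd) b' μ)
  obtain ⟨K₃, h₃, hresult⟩ := exists_evolves_route hB K₂ hF hentry hrow
    (word := fun j ω => (X j.1 ω * Y j.1 ω) j.2.1 j.2.2) fun ⟨i, u, w⟩ => by
      simp only [← blocks_mul_blocks_apply e, hT.mul_apply, Matrix.sum_apply, Matrix.smul_apply]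
      exact (Knows.pi fun μ => hproducts i μ (e u).2 (e w).2).comp
        fun P => ∑ μ, l (e u).1 (e w).1 μ • P μ
  refine ⟨K₃, ?_, fun i v => Knows.pi fun w => hresult (i, v, w)⟩
  convert (h₁.trans h₂).trans h₃ using 1
  ring

theorem CanMultiply.exists_evolves_powers {n B : ℕ} {F : Type*} [Semiring F] {q R : ℕ}
    (h : CanMultiply n B F (q + 1) R) {Ω : Type} (K : Fin n → Setoid Ω)
    {A : Ω → Matrix (Fin n) (Fin n) F} (hA : ∀ v, Knows (K v) fun ω => A ω v) :
    ∃ K', Evolves B (Nat.clog 2 q * R) K K' ∧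
      ∀ i ≤ q, ∀ v, Knows (K' v) fun ω => (A ω ^ i) v := by
  suffices hdouble : ∀ s, ∃ K', Evolves B (s * R) K K' ∧
      ∀ i ≤ q, i ≤ 2 ^ s → ∀ v, Knows (K' v) fun ω => (A ω ^ i) v by
    obtain ⟨K', hK', hknow⟩ := hdouble (Nat.clog 2 q)
    exact ⟨K', hK', fun i hi => hknow i hi (hi.trans (Nat.le_pow_clog one_lt_two q))⟩
  intro s
  induction s with
  | zero =>
    refine ⟨K, by simpa only [zero_mul] using Evolves.refl K, fun i _ hi v => ?_⟩
    rcases Nat.le_one_iff_eq_zero_or_eq_one.mp hi with rfl | rfl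
    · simpa only [pow_zero] using Knows.const _
    · simpa only [pow_one] using hA v
  | succ s ih =>
    obtain ⟨K₁, h₁, hknow₁⟩ := ih
    have hpow : 2 ^ (s + 1) = 2 * 2 ^ s := pow_succ' 2 s
    let exponent (i : Fin (q + 1)) : ℕ := min i (2 ^ (s + 1))
    have hle (i : Fin (q + 1)) : exponent i ≤ q ∧ exponent i ≤ 2 * 2 ^ s :=
      ⟨(min_le_left _ _).trans (Nat.lt_succ_iff.mp i.2), (min_le_right _ _).trans_eq hpow⟩
    obtain ⟨K₂, h₂, hknow₂⟩ := h K₁ (fun i ω => A ω ^ (exponent i / 2))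
      (fun i ω => A ω ^ (exponent i - exponent i / 2))
      (fun i v => hknow₁ _ (by grind) (by grind) v) fun i v => hknow₁ _ (by grind) (by grind) v
    refine ⟨K₂, by simpa only [Nat.succ_mul] using h₁.trans h₂, fun i hi hi' v => ?_⟩
    have hexp : exponent ⟨i, Nat.lt_succ_iff.mpr hi⟩ = i := min_eq_left hi'
    simpa only [hexp, ← pow_add, Nat.add_sub_of_le (Nat.div_le_self i 2)] using
      hknow₂ ⟨i, Nat.lt_succ_iff.mpr hi⟩ v

end CanMultiply

/-! ### Alternating matrices and matchings -/

section Alternating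

open Matrix

variable {ι : Type*}

/-- A matrix is alternating if it is skew-symmetric with zero diagonal; in characteristic two the
second condition is not implied by the first. -/
def IsAlternating {R : Type*} [Zero R] [Neg R] (A : Matrix ι ι R) : Prop :=
  Aᵀ = -A ∧ ∀ i, A i i = 0

theorem exists_mulVec_eq_zero_of_det_submatrix_eq_zero {R : Type*} [CommRing R] [IsDomain R]
    [Fintype ι] [DecidableEq ι] {A : Matrix ι ι R} {p : ι → Prop} [DecidablePred p]
    (h : (A.submatrix (Subtype.val : {k // p k} → ι) Subtype.val).det = 0) :
    ∃ x ≠ 0, (∀ k, ¬ p k → x k = 0) ∧ ∀ k, p k → (A *ᵥ x) k = 0 := by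
  obtain ⟨y, hy, hAy⟩ := exists_mulVec_eq_zero_iff.mpr h
  have hout (k : ι) (hk : ¬ p k) : Function.extend Subtype.val y 0 k = 0 :=
    Function.extend_apply' _ _ _ fun ⟨l, hl⟩ => hk (hl ▸ l.2)
  refine ⟨Function.extend Subtype.val y 0, fun hzero => hy (funext fun l => ?_), hout,
    fun k hk => ?_⟩
  · rw [← Subtype.val_injective.extend_apply y 0 l, hzero]
    rfl
  · refine .trans (Fintype.sum_of_injective _ Subtype.val_injective _ _ (fun l hl => ?_)
      fun l => ?_).symm (congrFun hAy ⟨k, hk⟩)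
    · rw [hout l fun hp => hl ⟨⟨l, hp⟩, rfl⟩, mul_zero]
    · simp only [submatrix_apply, Subtype.val_injective.extend_apply]

namespace IsAlternating

theorem submatrix {R κ : Type*} [Zero R] [Neg R] {A : Matrix ι ι R} (hA : IsAlternating A)
    (f : κ → ι) : IsAlternating (A.submatrix f f) :=
  ⟨by rw [transpose_submatrix, hA.1]; rfl, fun i => hA.2 (f i)⟩

theorem apply_swap {R : Type*} [Zero R] [Neg R] {A : Matrix ι ι R} (hA : IsAlternating A)
    (i j : ι) : A j i = -A i j :=
  congrFun (congrFun hA.1 i) j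

variable [Fintype ι]

theorem dotProduct_mulVec_self {R : Type*} [CommRing R] {A : Matrix ι ι R}
    (hA : IsAlternating A) (x : ι → R) : x ⬝ᵥ A *ᵥ x = 0 := by
  simp only [dotProduct, mulVec, Finset.mul_sum]
  rw [← Fintype.sum_prod_type' fun i j => x i * (A i j * x j)]
  refine Finset.sum_involution (fun p _ => p.swap) (fun p _ => ?_) (fun p _ hp hswap => hp ?_)
    (fun _ _ => Finset.mem_univ _) fun p _ => p.swap_swap
  · rw [Prod.fst_swap, Prod.snd_swap, hA.apply_swap p.1 p.2]
    ring
  · rw [show p.1 = p.2 from congrArg Prod.snd hswap, hA.2, zero_mul, mul_zero]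

variable [DecidableEq ι]

theorem pow_apply_swap {R : Type*} [CommRing R] {A : Matrix ι ι R} (hA : IsAlternating A) (m : ℕ)
    (i j : ι) : (A ^ m) j i = (-1) ^ m * (A ^ m) i j := by
  have h : (A ^ m)ᵀ = (-1 : R) ^ m • A ^ m := by
    rw [transpose_pow, hA.1, ← smul_pow, neg_one_smul]
  exact congrFun (congrFun h i) j

variable {F : Type*} [Field F]

theorem inv {A : Matrix ι ι F} (hA : IsAlternating A) (hdet : A.det ≠ 0) : IsAlternating A⁻¹ := by
  have hunit : IsUnit A.det := hdet.isUnit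
  refine ⟨?_, fun i => ?_⟩
  · rw [transpose_nonsing_inv, hA.1]
    exact inv_eq_left_inv (by rw [neg_mul_neg, nonsing_inv_mul _ hunit])
  · have h := hA.dotProduct_mulVec_self (A⁻¹ *ᵥ Pi.single i 1)
    rwa [mulVec_mulVec, mul_nonsing_inv _ hunit, one_mulVec, dotProduct_single_one,
      mulVec_single_one] at h

theorem exists_det_submatrix_ne_zero {A : Matrix ι ι F} (hA : IsAlternating A) (hdet : A.det ≠ 0)
    (i : ι) : ∃ j, A i j ≠ 0 ∧
      (A.submatrix (Subtype.val : {k // k ≠ i ∧ k ≠ j} → ι) Subtype.val).det ≠ 0 := by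
  have hunit : IsUnit A.det := hdet.isUnit
  obtain ⟨hskew, hdiag⟩ := hA.inv hdet
  obtain ⟨j, hj⟩ : ∃ j, A i j * A⁻¹ j i ≠ 0 := by
    by_contra! hzero
    have h := congrFun (congrFun (mul_nonsing_inv A hunit) i) i
    rw [mul_apply, Finset.sum_eq_zero fun j _ => hzero j, one_apply_eq] at h
    exact zero_ne_one h
  have hij : i ≠ j := by
    rintro rfl
    exact hj (by rw [hdiag, mul_zero])
  have hinv : A⁻¹ j i ≠ 0 := right_ne_zero_of_mul hj
  refine ⟨j, left_ne_zero_of_mul hj, fun hminor => ?_⟩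
  obtain ⟨x, hx₀, hout, hAx⟩ := exists_mulVec_eq_zero_of_det_submatrix_eq_zero hminor
  have hx (k : ι) : x k = A⁻¹ k i * (A *ᵥ x) i + A⁻¹ k j * (A *ᵥ x) j := by
    calc x k = (A⁻¹ *ᵥ (A *ᵥ x)) k := by
          rw [mulVec_mulVec, nonsing_inv_mul _ hunit, one_mulVec]
      _ = A⁻¹ k i * (A *ᵥ x) i + A⁻¹ k j * (A *ᵥ x) j :=
          Fintype.sum_eq_add i j hij fun l hl => by rw [hAx l hl, mul_zero]
  have hxi := hx i
  have hxj := hx j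
  have hinv' : A⁻¹ i j ≠ 0 := by
    rw [apply_swap ⟨hskew, hdiag⟩]
    exact neg_ne_zero.mpr hinv
  simp only [hout i (fun h => h.1 rfl), hout j (fun h => h.2 rfl), hdiag, zero_mul, zero_add,
    add_zero, zero_eq_mul, hinv, hinv', false_or] at hxi hxj
  refine hx₀ (funext fun k => ?_)
  rw [hx, hxi, hxj, mul_zero, mul_zero, add_zero, Pi.zero_apply]

theorem exists_isMatching {V : Type*} {G : SimpleGraph V} {A : Matrix V V F}
    (hA : IsAlternating A) (hG : ∀ i j, A i j ≠ 0 → G.Adj i j) {f : ι → V}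
    (hf : Function.Injective f) (hdet : (A.submatrix f f).det ≠ 0) :
    ∃ M : G.Subgraph, M.IsMatching ∧ M.verts = Set.range f := by
  induction hcard : Fintype.card ι using Nat.strong_induction_on generalizing ι with
  | _ n ih =>
    rcases isEmpty_or_nonempty ι with _ | ⟨⟨i⟩⟩
    · exact ⟨⊥, fun v hv => hv.elim, by rw [Set.range_eq_empty]; rfl⟩
    obtain ⟨j, hij, hminor⟩ := (hA.submatrix f).exists_det_submatrix_ne_zero hdet i
    have hadj := hG _ _ hij
    obtain ⟨M, hM, hverts⟩ := ih _ (hcard ▸ Fintype.card_subtype_lt (x := i) (by simp))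
      (hf.comp Subtype.val_injective) hminor rfl
    have hrange : M.verts = Set.range f \ {f i, f j} := by
      rw [hverts]
      ext v
      simp only [Set.mem_range, Function.comp_apply, Subtype.exists, Set.mem_sdiff,
        Set.mem_insert_iff, Set.mem_singleton_iff]
      grind [hf.eq_iff]
    refine ⟨M ⊔ G.subgraphOfAdj hadj, hM.sup (.subgraphOfAdj hadj) ?_, ?_⟩
    · rw [hM.support_eq_verts, SimpleGraph.support_subgraphOfAdj, hrange]
      exact Set.disjoint_sdiff_left
    · rw [SimpleGraph.Subgraph.verts_sup, hrange, SimpleGraph.subgraphOfAdj_verts]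
      exact Set.sdiff_union_of_subset (by grind)

end IsAlternating

end Alternating

/-! ### Reverse characteristic polynomials and powers -/

section ZeroRows

variable {V R : Type*} [Zero R]

/-- The matrix `A` with the rows indexed by `T` replaced by zero. -/
noncomputable def zeroRows (T : Set V) (A : Matrix V V R) : Matrix V V R :=
  Matrix.of (Tᶜ.indicator A)

theorem zeroRows_of_mem {T : Set V} {i : V} (hi : i ∈ T) (A : Matrix V V R) :
    zeroRows T A i = 0 :=
  Set.indicator_of_notMem (not_not.mpr hi) _

theorem zeroRows_of_notMem {T : Set V} {i : V} (hi : i ∉ T) (A : Matrix V V R) :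
    zeroRows T A i = A i :=
  Set.indicator_of_mem hi _

theorem zeroRows_empty (A : Matrix V V R) : zeroRows ∅ A = A :=
  funext fun _ => zeroRows_of_notMem (Set.notMem_empty _) A

theorem zeroRows_map {R R' : Type*} [Semiring R] [Semiring R'] (T : Set V) (A : Matrix V V R)
    (f : R →+* R') :
    (zeroRows T A).map f = zeroRows T (A.map f) := by
  ext i j
  by_cases hi : i ∈ T
  · simp [zeroRows_of_mem hi]
  · simp [zeroRows_of_notMem hi]

end ZeroRows

section CharpolyRev

open Matrix Polynomial

variable {V R : Type*} [Fintype V] [DecidableEq V] [CommRing R]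

theorem coeff_charpolyRev_eq_sum_minors (A : Matrix V V R) (d : ℕ) :
    A.charpolyRev.coeff d = (-1) ^ d * ∑ S ∈ Finset.univ.powersetCard d,
      (A.submatrix (Subtype.val : S → V) (Subtype.val : S → V)).det := by
  have h : A.charpolyRev = det (1 + (X : R[X]) • (-A).map C) := by
    rw [charpolyRev, Matrix.map_neg C (map_neg C), smul_neg, sub_eq_add_neg]
  rw [h, coeff_det_one_add_X_smul_eq_sum_minors, Finset.mul_sum]
  refine Finset.sum_congr rfl fun S hS => ?_
  rw [submatrix_neg, Pi.neg_apply, Pi.neg_apply, det_neg, Fintype.card_coe,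
    (Finset.mem_powersetCard.mp hS).2]

theorem charpolyRev_ne_zero [Nontrivial R] (A : Matrix V V R) : A.charpolyRev ≠ 0 := fun h => by
  simpa [h] using A.eval_charpolyRev

theorem natDegree_charpolyRev_le (A : Matrix V V R) : A.charpolyRev.natDegree ≤ Fintype.card V := by
  nontriviality R
  rw [← reverse_charpoly, ← A.charpoly_natDegree_eq_dim]
  exact reverse_natDegree_le _

theorem exists_minor_card_eq_natDegree_charpolyRev [Nontrivial R] (A : Matrix V V R) :
    ∃ S : Finset V, S.card = A.charpolyRev.natDegree ∧
      (A.submatrix (Subtype.val : S → V) (Subtype.val : S → V)).det ≠ 0 := by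
  have h := leadingCoeff_ne_zero.mpr (charpolyRev_ne_zero A)
  rw [leadingCoeff, coeff_charpolyRev_eq_sum_minors] at h
  obtain ⟨S, hS, hdet⟩ := Finset.exists_ne_zero_of_sum_ne_zero (right_ne_zero_of_mul h)
  exact ⟨S, (Finset.mem_powersetCard.mp hS).2, hdet⟩

theorem charpolyRev_map {R' : Type*} [CommRing R'] (A : Matrix V V R) (f : R →+* R') :
    (A.map f).charpolyRev = A.charpolyRev.map f := by
  rw [charpolyRev, charpolyRev, ← coe_mapRingHom, RingHom.map_det]
  congr 1
  ext i j : 2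
  simp [one_apply, apply_ite (Polynomial.map f)]

theorem totalDegree_det_le {σ : Type*} {A : Matrix V V (MvPolynomial σ R)}
    (hA : ∀ i j, (A i j).totalDegree ≤ 1) : A.det.totalDegree ≤ Fintype.card V := by
  rw [det_apply]
  refine MvPolynomial.totalDegree_finsetSum_le fun π _ => ?_
  have hsign : ∀ z : ℤˣ, ∀ p : MvPolynomial σ R, (z • p).totalDegree = p.totalDegree := by
    intro z p
    rcases Int.units_eq_one_or z with rfl | rfl <;> simp
  calc _ ≤ ∑ i, (A (π i) i).totalDegree := by
        rw [hsign]
        exact MvPolynomial.totalDegree_finsetProd _ _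
    _ ≤ _ := (Finset.sum_le_card_nsmul _ _ 1 fun i _ => hA (π i) i).trans (by simp)

theorem totalDegree_coeff_charpolyRev_le {σ : Type*} {A : Matrix V V (MvPolynomial σ R)}
    (hA : ∀ i j, (A i j).totalDegree ≤ 1) (d : ℕ) :
    (A.charpolyRev.coeff d).totalDegree ≤ Fintype.card V := by
  rw [coeff_charpolyRev_eq_sum_minors, Finset.mul_sum]
  refine MvPolynomial.totalDegree_finsetSum_le fun S _ => ?_
  calc _ = ((A.submatrix (Subtype.val : S → V) (Subtype.val : S → V)).det).totalDegree := by
        rcases neg_one_pow_eq_or (MvPolynomial σ R) d with h | h <;> simp [h]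
    _ ≤ Fintype.card S :=
        totalDegree_det_le (A := A.submatrix Subtype.val Subtype.val) fun i j => hA i j
    _ = S.card := Fintype.card_coe S
    _ ≤ _ := Finset.card_le_univ S

theorem coe_charpolyRev (A : Matrix V V R) :
    (A.charpolyRev : PowerSeries R) =
      (1 - (PowerSeries.X : PowerSeries R) • A.map PowerSeries.C).det := by
  rw [charpolyRev, ← coeToPowerSeries.ringHom_apply, RingHom.map_det]
  congr 1
  ext i j : 2
  rcases eq_or_ne i j with rfl | hij
  · simp [(PowerSeries.commute_X _).eq]
  · simp [hij, (PowerSeries.commute_X _).eq]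

theorem one_sub_X_smul_mul_mk_pow (A : Matrix V V R) :
    (1 - (PowerSeries.X : PowerSeries R) • A.map PowerSeries.C) *
      Matrix.of (fun i j => PowerSeries.mk fun m => (A ^ m) i j) = 1 := by
  ext i j m
  rw [sub_mul, one_mul, smul_mul_assoc, Matrix.sub_apply, Matrix.smul_apply, mul_apply]
  cases m with
  | zero => simp [one_apply, apply_ite (PowerSeries.constantCoeff (R := R))]
  | succ m =>
    simp [one_apply, apply_ite (PowerSeries.coeff (R := R) (m + 1)), pow_succ', mul_apply]

-- Cramer's rule for the resolvent `∑ m, X ^ m • A ^ m = (1 - X • A)⁻¹`.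
theorem charpolyRev_mul_mk_pow_apply (A : Matrix V V R) (v : V) :
    (A.charpolyRev : PowerSeries R) * PowerSeries.mk (fun m => (A ^ m) v v) =
      ((zeroRows {v} A).charpolyRev : PowerSeries R) := by
  set Q : Matrix V V (PowerSeries R) := 1 - (PowerSeries.X : PowerSeries R) • A.map PowerSeries.C
  let T : Matrix V V (PowerSeries R) := Matrix.of fun i j => PowerSeries.mk fun m => (A ^ m) i j
  have hrow : Q.updateRow v (Pi.single v 1) =
      1 - (PowerSeries.X : PowerSeries R) • (zeroRows {v} A).map PowerSeries.C := by
    ext i j : 2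
    by_cases hi : i = v
    · subst hi
      simp [zeroRows_of_mem, one_apply, Pi.single_apply, eq_comm]
    · simp [Q, zeroRows_of_notMem, hi]
  calc _ = (Q.adjugate * Q * T) v v := by
        rw [adjugate_mul, coe_charpolyRev, smul_mul_assoc, one_mul]
        rfl
    _ = Q.adjugate v v := by rw [mul_assoc, one_sub_X_smul_mul_mk_pow, mul_one]
    _ = _ := by rw [adjugate_apply, hrow, coe_charpolyRev]

end CharpolyRev

/-! ### Generic Tutte matrices -/

section Matchings

theorem ncard_verts_eq_two_mul_ncard_edgeSet {V : Type*} [Finite V] {G : SimpleGraph V}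
    {M : G.Subgraph} (h : M.IsMatching) : M.verts.ncard = 2 * M.edgeSet.ncard := by
  have := Fintype.ofFinite M.edgeSet
  have hfiber : ∀ e : M.edgeSet, Nat.card {v // h.toEdge v = e} = 2 := by
    rintro ⟨⟨u, v⟩, he⟩
    have huv : M.Adj u v := he
    change Nat.card (h.toEdge ⁻¹' {⟨s(u, v), huv⟩}) = 2
    rw [h.toEdge_preimage_singleton huv, Nat.card_coe_set_eq]
    exact Set.ncard_pair fun hne => huv.ne (congrArg Subtype.val hne)
  rw [← Nat.card_coe_set_eq, ← Nat.card_coe_set_eq,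
    Nat.card_congr (Equiv.sigmaFiberEquiv h.toEdge).symm, Nat.card_sigma,
    Finset.sum_congr rfl fun e _ => hfiber e]
  simp [mul_comm]

/-- The largest number of vertices covered by a matching of `G` that misses all vertices in `T`. -/
noncomputable def maxCovered {V : Type*} (G : SimpleGraph V) (T : Set V) : ℕ :=
  sSup {k | ∃ M : G.Subgraph, M.IsMatching ∧ Disjoint M.verts T ∧ M.verts.ncard = k}

theorem bddAbove_ncard_verts {V : Type*} [Finite V] (G : SimpleGraph V) (T : Set V) :
    BddAbove {k | ∃ M : G.Subgraph, M.IsMatching ∧ Disjoint M.verts T ∧ M.verts.ncard = k} := by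
  refine ⟨Nat.card V, ?_⟩
  rintro _ ⟨M, -, -, rfl⟩
  exact Set.ncard_le_card _

theorem ncard_verts_le_maxCovered {V : Type*} [Finite V] {G : SimpleGraph V} {T : Set V}
    {M : G.Subgraph} (hM : M.IsMatching) (hT : Disjoint M.verts T) :
    M.verts.ncard ≤ maxCovered G T :=
  le_csSup (bddAbove_ncard_verts G T) ⟨M, hM, hT, rfl⟩

theorem exists_isMatching_ncard_verts_eq_maxCovered {V : Type*} [Finite V] (G : SimpleGraph V)
    (T : Set V) :
    ∃ M : G.Subgraph, M.IsMatching ∧ Disjoint M.verts T ∧ M.verts.ncard = maxCovered G T :=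
  Nat.sSup_mem (s := {k | ∃ M : G.Subgraph, M.IsMatching ∧ Disjoint M.verts T ∧ M.verts.ncard = k})
    ⟨0, ⊥, fun _ hv => hv.elim, by simp, by simp⟩ (bddAbove_ncard_verts G T)

theorem isMaximumMatching_iff {V : Type} [Finite V] {G : SimpleGraph V} {M : G.Subgraph} :
    G.IsMaximumMatching M ↔ M.IsMatching ∧ maxCovered G ∅ ≤ M.verts.ncard := by
  refine and_congr_right fun hM => ⟨fun hmax => ?_, fun hle M' hM' => ?_⟩
  · obtain ⟨M', hM', -, hcard⟩ := exists_isMatching_ncard_verts_eq_maxCovered G ∅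
    rw [← hcard, ncard_verts_eq_two_mul_ncard_edgeSet hM, ncard_verts_eq_two_mul_ncard_edgeSet hM']
    exact Nat.mul_le_mul_left 2 (hmax M' hM')
  · have h := (ncard_verts_le_maxCovered hM' (Set.disjoint_empty _)).trans hle
    rw [ncard_verts_eq_two_mul_ncard_edgeSet hM, ncard_verts_eq_two_mul_ncard_edgeSet hM'] at h
    exact Nat.le_of_mul_le_mul_left h two_pos

theorem mem_gallaiEdmondsD_iff_maxCovered_le {V : Type} [Finite V] {G : SimpleGraph V} {v : V} :
    v ∈ G.gallaiEdmondsD ↔ maxCovered G ∅ ≤ maxCovered G {v} := by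
  constructor
  · rintro ⟨M, hM, hv⟩
    obtain ⟨hM, hle⟩ := isMaximumMatching_iff.mp hM
    exact hle.trans (ncard_verts_le_maxCovered hM (Set.disjoint_singleton_right.mpr hv))
  · intro hle
    obtain ⟨M, hM, hv, hcard⟩ := exists_isMatching_ncard_verts_eq_maxCovered G {v}
    exact ⟨M, isMaximumMatching_iff.mpr ⟨hM, hcard ▸ hle⟩, Set.disjoint_singleton_right.mp hv⟩

end Matchings

section TutteMatrix

variable {V R F : Type*} [LinearOrder V] [CommRing R] [Field F] {G : SimpleGraph V}

open scoped Classical in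
/-- The Tutte matrix of `G` whose entries above the diagonal are the `a (i, j)` for the edges `ij`
with `i < j`. -/
noncomputable def tutteMatrix (G : SimpleGraph V) (a : V × V → R) : Matrix V V R :=
  Matrix.of fun i j => if G.Adj i j then (if i < j then a (i, j) else -a (j, i)) else 0

theorem isAlternating_tutteMatrix (a : V × V → R) : IsAlternating (tutteMatrix G a) := by
  refine ⟨?_, fun i => by simp [tutteMatrix]⟩
  ext i j
  by_cases h : G.Adj i j
  · rcases lt_or_gt_of_ne h.ne with hlt | hlt <;>
      simp [tutteMatrix, h, h.symm, hlt, hlt.asymm]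
  · simp [tutteMatrix, h, G.adj_comm j i]

theorem adj_of_tutteMatrix_ne_zero {a : V × V → R} {i j : V} (h : tutteMatrix G a i j ≠ 0) :
    G.Adj i j := by
  by_contra hadj
  exact h (by simp [tutteMatrix, hadj])

theorem tutteMatrix_map {R' : Type*} [CommRing R'] (f : R →+* R') (a : V × V → R) :
    (tutteMatrix G a).map f = tutteMatrix G fun q => f (a q) := by
  ext i j
  simp only [tutteMatrix, Matrix.map_apply, Matrix.of_apply]
  split_ifs <;> simp

theorem totalDegree_tutteMatrix_X_le [Nontrivial R] (i j : V) :
    (tutteMatrix G (MvPolynomial.X (R := R)) i j).totalDegree ≤ 1 := by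
  simp only [tutteMatrix, Matrix.of_apply]
  split_ifs <;> simp

open scoped Classical in
/-- The entries that specialize the Tutte matrix of `G` to that of the matching `M`. -/
noncomputable def matchingEntries (R : Type*) [CommRing R] (M : G.Subgraph) : V × V → R :=
  fun q => if M.Adj q.1 q.2 then 1 else 0

open scoped Classical in
theorem tutteMatrix_matchingEntries_apply (M : G.Subgraph) (i j : V) :
    tutteMatrix G (matchingEntries R M) i j =
      if M.Adj i j then (if i < j then 1 else -1) else 0 := by
  by_cases h : M.Adj i j
  · simp [tutteMatrix, matchingEntries, h, h.symm, h.adj_sub]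
  · simp [tutteMatrix, matchingEntries, h, M.adj_comm j i]

theorem tutteMatrix_matchingEntries_ne_zero [Nontrivial R] {M : G.Subgraph} {i j : V} :
    tutteMatrix G (matchingEntries R M) i j ≠ 0 ↔ M.Adj i j := by
  rw [tutteMatrix_matchingEntries_apply]
  split_ifs <;> simp [*]

theorem tutteMatrix_matchingEntries_of_notMem {M : G.Subgraph} {i : V} (hi : i ∉ M.verts) :
    tutteMatrix G (matchingEntries R M) i = 0 := by
  ext j
  rw [tutteMatrix_matchingEntries_apply, if_neg fun h => hi (M.edge_vert h), Pi.zero_apply]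

theorem det_tutteMatrix_matchingEntries_ne_zero {M : G.Subgraph} (hM : M.IsMatching)
    {S : Finset V} (hS : (S : Set V) = M.verts) :
    ((tutteMatrix G (matchingEntries F M)).submatrix
      (Subtype.val : S → V) (Subtype.val : S → V)).det ≠ 0 := by
  intro hdet
  obtain ⟨x, hx, hker⟩ := Matrix.exists_mulVec_eq_zero_iff.mpr hdet
  refine hx (funext fun i => ?_)
  obtain ⟨j, hij, -⟩ := hM (hS ▸ i.2 : (i : V) ∈ M.verts)
  have hj : j ∈ S := by
    rw [← Finset.mem_coe, hS]
    exact M.edge_vert hij.symm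
  have hrow := congrFun hker ⟨j, hj⟩
  rw [Matrix.mulVec, dotProduct, Finset.sum_eq_single i] at hrow
  · exact (mul_eq_zero.mp hrow).resolve_left (tutteMatrix_matchingEntries_ne_zero.mpr hij.symm)
  · intro k _ hk
    refine mul_eq_zero_of_left (not_ne_iff.mp fun h => hk (Subtype.ext ?_)) _
    exact hM.eq_of_adj_left (tutteMatrix_matchingEntries_ne_zero.mp h) hij.symm
  · simp

variable [Fintype V]

theorem coeff_charpolyRev_tutteMatrix_matchingEntries_ne_zero {M : G.Subgraph}
    (hM : M.IsMatching) :
    (tutteMatrix G (matchingEntries F M)).charpolyRev.coeff M.verts.ncard ≠ 0 := by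
  classical
  rw [coeff_charpolyRev_eq_sum_minors, Set.ncard_eq_toFinset_card',
    Finset.sum_eq_single M.verts.toFinset]
  · exact mul_ne_zero (pow_ne_zero _ (neg_ne_zero.mpr one_ne_zero))
      (det_tutteMatrix_matchingEntries_ne_zero hM (Set.coe_toFinset _))
  · intro S hS hne
    obtain ⟨i, hi, hiM⟩ : ∃ i ∈ S, i ∉ M.verts.toFinset :=
      Finset.not_subset.mp fun hsub =>
        hne (Finset.eq_of_subset_of_card_le hsub (Finset.mem_powersetCard.mp hS).2.ge)
    refine Matrix.det_eq_zero_of_row_eq_zero ⟨i, hi⟩ fun j => ?_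
    exact congrFun (tutteMatrix_matchingEntries_of_notMem (Set.mem_toFinset.not.mp hiM)) j.1
  · exact fun h => (h (Finset.mem_powersetCard_univ.mpr rfl)).elim

theorem natDegree_charpolyRev_zeroRows_tutteMatrix_le (T : Set V) (a : V × V → F) :
    (zeroRows T (tutteMatrix G a)).charpolyRev.natDegree ≤ maxCovered G T := by
  obtain ⟨S, hS, hdet⟩ := exists_minor_card_eq_natDegree_charpolyRev (zeroRows T (tutteMatrix G a))
  have hST : ∀ i : S, (i : V) ∉ T := fun i hi =>
    hdet (Matrix.det_eq_zero_of_row_eq_zero i fun j => congrFun (zeroRows_of_mem hi _) j.1)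
  have hminor :
      (zeroRows T (tutteMatrix G a)).submatrix (Subtype.val : S → V) (Subtype.val : S → V) =
        (tutteMatrix G a).submatrix Subtype.val Subtype.val :=
    Matrix.ext fun i j => congrFun (zeroRows_of_notMem (hST i) (tutteMatrix G a)) j.1
  rw [hminor] at hdet
  obtain ⟨M, hM, hverts⟩ := (isAlternating_tutteMatrix a).exists_isMatching
    (fun i j => adj_of_tutteMatrix_ne_zero) Subtype.val_injective hdet
  rw [Subtype.range_val_subtype] at hverts
  rw [← hS, ← Set.ncard_coe_finset, ← Finset.setOfPred_mem, ← hverts]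
  refine ncard_verts_le_maxCovered hM (Set.disjoint_left.mpr fun i hi => ?_)
  rw [hverts] at hi
  exact hST ⟨i, hi⟩

theorem eval_coeff_charpolyRev_zeroRows_tutteMatrix_X (T : Set V) (a : V × V → R) (d : ℕ) :
    MvPolynomial.eval a ((zeroRows T (tutteMatrix G MvPolynomial.X)).charpolyRev.coeff d) =
      (zeroRows T (tutteMatrix G a)).charpolyRev.coeff d := by
  rw [← Polynomial.coeff_map, ← charpolyRev_map, zeroRows_map, tutteMatrix_map]
  simp only [MvPolynomial.eval_X]

theorem coeff_charpolyRev_zeroRows_tutteMatrix_X_ne_zero (T : Set V) :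
    (zeroRows T (tutteMatrix G (MvPolynomial.X (R := F)))).charpolyRev.coeff (maxCovered G T) ≠
      0 := by
  obtain ⟨M, hM, hT, hcard⟩ := exists_isMatching_ncard_verts_eq_maxCovered G T
  have hzero : zeroRows T (tutteMatrix G (matchingEntries F M)) =
      tutteMatrix G (matchingEntries F M) := by
    funext i
    by_cases hi : i ∈ T
    · rw [zeroRows_of_mem hi, tutteMatrix_matchingEntries_of_notMem
        fun h => Set.disjoint_left.mp hT h hi]
    · rw [zeroRows_of_notMem hi]
  intro h
  apply coeff_charpolyRev_tutteMatrix_matchingEntries_ne_zero (F := F) hM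
  rw [← hzero, hcard, ← eval_coeff_charpolyRev_zeroRows_tutteMatrix_X, h, map_zero]

theorem natDegree_charpolyRev_eq_maxCovered {T : Set V} {a : V × V → F}
    (h : MvPolynomial.eval a
      ((zeroRows T (tutteMatrix G MvPolynomial.X)).charpolyRev.coeff (maxCovered G T)) ≠ 0) :
    (zeroRows T (tutteMatrix G a)).charpolyRev.natDegree = maxCovered G T := by
  rw [eval_coeff_charpolyRev_zeroRows_tutteMatrix_X] at h
  exact (natDegree_charpolyRev_zeroRows_tutteMatrix_le T a).antisymm
    (Polynomial.le_natDegree_of_ne_zero h)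

theorem totalDegree_coeff_charpolyRev_zeroRows_tutteMatrix_X_le [Nontrivial R] (T : Set V)
    (d : ℕ) :
    ((zeroRows T (tutteMatrix G (MvPolynomial.X (R := R)))).charpolyRev.coeff d).totalDegree ≤
      Fintype.card V := by
  refine totalDegree_coeff_charpolyRev_le (fun i j => ?_) d
  by_cases hi : i ∈ T
  · simp [zeroRows_of_mem hi]
  · rw [zeroRows_of_notMem hi]
    exact totalDegree_tutteMatrix_X_le i j

end TutteMatrix

section SchwartzZippel

variable {σ F : Type*} [Finite σ] [Field F] [Fintype F]

theorem card_zeros_mul_card_le {p : MvPolynomial σ F} (hp : p ≠ 0) {d : ℕ}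
    (hd : p.totalDegree ≤ d) :
    Nat.card {a : σ → F // MvPolynomial.eval a p = 0} * Fintype.card F ≤
      d * Nat.card (σ → F) := by
  classical
  let e := Finite.equivFin σ
  let q := MvPolynomial.rename e p
  have hq : q ≠ 0 := (MvPolynomial.rename_injective e e.injective).ne_iff' (map_zero _) |>.mpr hp
  have hcard : Nat.card {a : σ → F // MvPolynomial.eval a p = 0} =
      ((Fintype.piFinset fun _ => (Finset.univ : Finset F)).filter
        fun f => MvPolynomial.eval f q = 0).card := by
    rw [Fintype.piFinset_univ, ← Fintype.card_subtype, ← Nat.card_eq_fintype_card]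
    refine Nat.card_congr ((Equiv.arrowCongr e (Equiv.refl F)).subtypeEquiv fun a => ?_)
    have ha : (Equiv.arrowCongr e (Equiv.refl F)) a ∘ e = a := by
      funext i
      simp
    rw [MvPolynomial.eval_rename, ha]
  have hF : (0 : ℚ≥0) < Fintype.card F := by exact_mod_cast Fintype.card_pos
  have h := MvPolynomial.schwartz_zippel_totalDegree hq Finset.univ
  rw [← hcard, Finset.card_univ, div_le_div_iff₀ (pow_pos hF _) hF] at h
  rw [Nat.card_fun, Nat.card_eq_fintype_card (α := F)]
  calc _ ≤ q.totalDegree * Fintype.card F ^ Nat.card σ := by exact_mod_cast h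
    _ ≤ _ := Nat.mul_le_mul_right _ ((MvPolynomial.totalDegree_rename_le _ _).trans hd)

theorem card_exists_zero_mul_card_le {ι : Type*} [Fintype ι] {p : ι → MvPolynomial σ F}
    (hp : ∀ i, p i ≠ 0) {d : ℕ} (hd : ∀ i, (p i).totalDegree ≤ d) :
    Nat.card {a : σ → F // ∃ i, MvPolynomial.eval a (p i) = 0} * Fintype.card F ≤
      Fintype.card ι * d * Nat.card (σ → F) := by
  classical
  have := Fintype.ofFinite σ
  have hunion : Nat.card {a : σ → F // ∃ i, MvPolynomial.eval a (p i) = 0} ≤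
      ∑ i, Nat.card {a : σ → F // MvPolynomial.eval a (p i) = 0} := by
    simp only [Nat.card_eq_fintype_card, Fintype.card_subtype]
    refine (Finset.card_le_card fun a ha => ?_).trans Finset.card_biUnion_le
    simpa using ha
  calc _ ≤ ∑ i, Nat.card {a : σ → F // MvPolynomial.eval a (p i) = 0} * Fintype.card F := by
        rw [← Finset.sum_mul]
        exact Nat.mul_le_mul_right _ hunion
    _ ≤ ∑ _i : ι, d * Nat.card (σ → F) :=
        Finset.sum_le_sum fun i _ => card_zeros_mul_card_le (hp i) (hd i)
    _ = _ := by rw [Finset.sum_const, Finset.card_univ, smul_eq_mul, mul_assoc]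

theorem card_natDegree_charpolyRev_ne_maxCovered_le {V : Type*} [LinearOrder V] [Fintype V]
    (G : SimpleGraph V) {ι : Type*} [Fintype ι] (T : ι → Set V) :
    Nat.card {a : V × V → F // ∃ i,
      (zeroRows (T i) (tutteMatrix G a)).charpolyRev.natDegree ≠ maxCovered G (T i)} *
        Fintype.card F ≤ Fintype.card ι * Fintype.card V * Nat.card (V × V → F) := by
  refine le_trans (Nat.mul_le_mul_right _ (Nat.card_le_card_of_injective
    (Subtype.impEmbedding _ _ fun a ⟨i, hi⟩ => ⟨i, ?_⟩) (Subtype.impEmbedding _ _ _).injective))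
    (card_exists_zero_mul_card_le
      (fun i => coeff_charpolyRev_zeroRows_tutteMatrix_X_ne_zero (G := G) (T i))
      fun i => totalDegree_coeff_charpolyRev_zeroRows_tutteMatrix_X_le (T i) _)
  by_contra h
  exact hi (natDegree_charpolyRev_eq_maxCovered h)

end SchwartzZippel

section StrictlyProper

variable {F : Type*} [Field F] {n : ℕ}

/-- The sequence `s` agrees up to index `2 * n` with the coefficients of a rational function with a
denominator of degree at most `n` and a numerator of smaller degree. -/
def IsStrictlyProper (n : ℕ) (s : ℕ → F) : Prop :=
  ∃ N Q : Polynomial F, Q.natDegree ≤ n ∧ N.degree < Q.degree ∧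
    ∀ m ≤ 2 * n, PowerSeries.coeff m ((Q : PowerSeries F) * PowerSeries.mk s) = N.coeff m

theorem isStrictlyProper_congr {s s' : ℕ → F} (h : ∀ m ≤ 2 * n, s m = s' m) :
    IsStrictlyProper n s ↔ IsStrictlyProper n s' := by
  refine exists_congr fun N => exists_congr fun Q => and_congr_right fun _ =>
    and_congr_right fun _ => forall₂_congr fun m hm => ?_
  rw [PowerSeries.coeff_mul, PowerSeries.coeff_mul, Finset.sum_congr rfl fun p hp => ?_]
  rw [PowerSeries.coeff_mk, PowerSeries.coeff_mk,
    h p.2 ((Finset.HasAntidiagonal.antidiagonal.snd_le hp).trans hm)]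

theorem mul_eq_mul_of_coeff_mul_mk_eq {s : ℕ → F} {N Q N' Q' : Polynomial F}
    (hN : N.natDegree ≤ n) (hQ : Q.natDegree ≤ n) (hN' : N'.natDegree ≤ n) (hQ' : Q'.natDegree ≤ n)
    (h : (Q : PowerSeries F) * PowerSeries.mk s = N)
    (h' : ∀ m ≤ 2 * n, PowerSeries.coeff m ((Q' : PowerSeries F) * PowerSeries.mk s) = N'.coeff m) :
    Q' * N = Q * N' := by
  ext m
  by_cases hm : m ≤ 2 * n
  · rw [← Polynomial.coeff_coe, ← Polynomial.coeff_coe, Polynomial.coe_mul, ← h, mul_left_comm,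
      PowerSeries.coeff_mul, Polynomial.coe_mul, PowerSeries.coeff_mul]
    refine Finset.sum_congr rfl fun p hp => ?_
    rw [h' p.2 ((Finset.HasAntidiagonal.antidiagonal.snd_le hp).trans hm), Polynomial.coeff_coe N']
  · rw [Polynomial.coeff_eq_zero_of_natDegree_lt, Polynomial.coeff_eq_zero_of_natDegree_lt]
    · exact Polynomial.natDegree_mul_le.trans_lt (by omega)
    · exact Polynomial.natDegree_mul_le.trans_lt (by omega)

theorem isStrictlyProper_iff_natDegree_lt {s : ℕ → F} {N Q : Polynomial F} (hQn : Q.natDegree ≤ n)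
    (hNn : N.natDegree ≤ n) (hN : N ≠ 0) (hQ : Q ≠ 0)
    (h : (Q : PowerSeries F) * PowerSeries.mk s = N) :
    IsStrictlyProper n s ↔ N.natDegree < Q.natDegree := by
  constructor
  · rintro ⟨N', Q', hQ'n, hdeg, hcoeff⟩
    have hQ' : Q' ≠ 0 := Polynomial.ne_zero_of_degree_gt hdeg
    have hcross : Q' * N = Q * N' := mul_eq_mul_of_coeff_mul_mk_eq hNn hQn
      ((Polynomial.natDegree_le_natDegree hdeg.le).trans hQ'n) hQ'n h hcoeff
    have hN' : N' ≠ 0 := right_ne_zero_of_mul (hcross ▸ mul_ne_zero hQ' hN)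
    have hnatDegree := congrArg Polynomial.natDegree hcross
    rw [Polynomial.natDegree_mul hQ' hN, Polynomial.natDegree_mul hQ hN'] at hnatDegree
    have := Polynomial.natDegree_lt_natDegree hN' hdeg
    omega
  · intro hlt
    refine ⟨N, Q, hQn, Polynomial.degree_lt_degree hlt, fun m _ => ?_⟩
    rw [h, Polynomial.coeff_coe]

end StrictlyProper

section GallaiEdmonds

variable {V F : Type} [LinearOrder V] [Fintype V] [Field F] {G : SimpleGraph V}

theorem mem_gallaiEdmondsD_iff_not_isStrictlyProper {a : V × V → F} {v : V}
    (h : (tutteMatrix G a).charpolyRev.natDegree = maxCovered G ∅)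
    (hv : (zeroRows {v} (tutteMatrix G a)).charpolyRev.natDegree = maxCovered G {v}) :
    v ∈ G.gallaiEdmondsD ↔
      ¬ IsStrictlyProper (Fintype.card V) fun m => (tutteMatrix G a ^ m) v v := by
  rw [isStrictlyProper_iff_natDegree_lt (natDegree_charpolyRev_le _) (natDegree_charpolyRev_le _)
    (charpolyRev_ne_zero _) (charpolyRev_ne_zero _) (charpolyRev_mul_mk_pow_apply _ v), not_lt, h,
    hv, mem_gallaiEdmondsD_iff_maxCovered_le]

variable (F G) in
theorem card_not_mem_gallaiEdmondsD_iff_le [Fintype F] :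
    Nat.card {a : V × V → F // ¬ ∀ v, v ∈ G.gallaiEdmondsD ↔
      ¬ IsStrictlyProper (Fintype.card V) fun m => (tutteMatrix G a ^ m) v v} * Fintype.card F ≤
        (Fintype.card V + 1) * Fintype.card V * Nat.card (V × V → F) := by
  rw [← Fintype.card_option]
  refine le_trans (Nat.mul_le_mul_right _ (Nat.card_le_card_of_injective
    (Subtype.impEmbedding _ _ fun a ha => ?_) (Subtype.impEmbedding _ _ _).injective))
    (card_natDegree_charpolyRev_ne_maxCovered_le G fun o : Option V => o.elim ∅ singleton)
  by_contra! hgeneric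
  have h := hgeneric none
  rw [Option.elim_none, zeroRows_empty] at h
  exact ha fun v => mem_gallaiEdmondsD_iff_not_isStrictlyProper h (hgeneric (some v))

end GallaiEdmonds

/-! ### The protocol -/

section Broadcast

variable {n B b : ℕ} {Ω : Type} {α : Type*} [Fintype α]

theorem exists_evolves_exchange (hB : 1 ≤ B) (K : Fin n → Setoid Ω) (hα : Fintype.card α ≤ 2 ^ b)
    {word : Fin n → Fin n → Ω → α} (hword : ∀ u v, Knows (K u) (word u v)) :
    ∃ K', Evolves B (4 * b) K K' ∧ ∀ u v, Knows (K' v) (word u v) := by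
  obtain ⟨K', h, hknow⟩ := exists_evolves_route hB K (L := 1) hα
    (src := Prod.fst) (dst := Prod.snd) (word := fun j : Fin n × Fin n => word j.1 j.2)
    (.of_injective Prod.snd (fun _ _ h => h) (by simp))
    (.of_injective Prod.fst (fun _ _ h => Prod.swap_injective h) (by simp))
    fun j => hword j.1 j.2
  exact ⟨K', by simpa only [one_mul] using h, fun u v => hknow (u, v)⟩

theorem exists_evolves_broadcast_set (hB : 1 ≤ B) (K : Fin n → Setoid Ω) {S : Ω → Set (Fin n)}
    (hS : ∀ u, Knows (K u) fun ω => u ∈ S ω) :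
    ∃ K', Evolves B 4 K K' ∧ ∀ v, Knows (K' v) S := by
  obtain ⟨K', h, hknow⟩ := exists_evolves_exchange (b := 1) hB K (α := Prop) (by simp)
    fun u _ => hS u
  exact ⟨K', h, fun v => Knows.pi fun u => hknow u v⟩

end Broadcast

section Decomposition

/-- The triple that is the Gallai–Edmonds decomposition of `G` if `D` is its first part. -/
def decompositionOf {V : Type*} (G : SimpleGraph V) (D : Set V) : Set V × Set V × Set V :=
  let K := {v | v ∉ D ∧ ∃ w ∈ D, G.Adj v w}
  (D, K, (D ∪ K)ᶜ)

theorem decompositionOf_gallaiEdmondsD {V : Type} (G : SimpleGraph V) :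
    decompositionOf G G.gallaiEdmondsD = G.gallaiEdmonds :=
  rfl

theorem exists_evolves_decompositionOf {n B : ℕ} {Ω : Type} (hB : 1 ≤ B) (K : Fin n → Setoid Ω)
    {G : Ω → SimpleGraph (Fin n)} (hG : ∀ v, Knows (K v) fun ω => (G ω).neighborSet v)
    {D : Ω → Set (Fin n)} (hD : ∀ v, Knows (K v) fun ω => v ∈ D ω) :
    ∃ K', Evolves B 8 K K' ∧ ∀ v, Knows (K' v) fun ω => decompositionOf (G ω) (D ω) := by
  obtain ⟨K₁, h₁, hD₁⟩ := exists_evolves_broadcast_set hB K hD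
  obtain ⟨K₂, h₂, hN⟩ := exists_evolves_broadcast_set hB K₁
    (S := fun ω => {v | v ∉ D ω ∧ ∃ w ∈ D ω, (G ω).Adj v w})
    fun v => ((hD₁ v).prodMk ((hG v).mono (h₁.le v))).comp fun x => v ∉ x.1 ∧ ∃ w ∈ x.1, w ∈ x.2
  exact ⟨K₂, h₁.trans h₂, fun v =>
    (((hD₁ v).mono (h₂.le v)).prodMk (hN v)).comp fun x => (x.1, x.2, (x.1 ∪ x.2)ᶜ)⟩

end Decomposition

section Powers

variable {n B q R : ℕ} {Ω F : Type} [CommRing F]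

theorem IsAlternating.pow_apply_self {V : Type*} [Fintype V] [DecidableEq V]
    {A : Matrix V V F} (hA : IsAlternating A) (q m : ℕ) (v : V) :
    (A ^ m) v v = ∑ u, (A ^ (m % q)) v u * ((-1) ^ (q * (m / q)) * ((A ^ q) ^ (m / q)) v u) := by
  conv_lhs => rw [← Nat.mod_add_div m q, pow_add, Matrix.mul_apply]
  simp only [hA.pow_apply_swap (q * (m / q)) v, pow_mul A]

-- Baby steps and giant steps: the entry `(A ^ (i + q * j)) v v` pairs row `v` of `A ^ i` with
-- column `v` of `(A ^ q) ^ j`, which is row `v` up to sign because `A` is alternating.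
theorem CanMultiply.exists_evolves_pow_apply_self (h : CanMultiply n B F (q + 1) R)
    (K : Fin n → Setoid Ω) {A : Ω → Matrix (Fin n) (Fin n) F} (hA : ∀ ω, IsAlternating (A ω))
    (hknow : ∀ v, Knows (K v) fun ω => A ω v) :
    ∃ K', Evolves B (2 * (Nat.clog 2 q * R)) K K' ∧
      ∀ m ≤ q * q, ∀ v, Knows (K' v) fun ω => (A ω ^ m) v v := by
  obtain ⟨K₁, h₁, hbaby⟩ := h.exists_evolves_powers K hknow
  obtain ⟨K₂, h₂, hgiant⟩ := h.exists_evolves_powers K₁ (hbaby q le_rfl)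
  refine ⟨K₂, by simpa only [two_mul] using h₁.trans h₂, fun m hm v => ?_⟩
  rcases q.eq_zero_or_pos with rfl | hq
  · simpa only [Nat.le_zero.mp hm, pow_zero] using Knows.const _
  simp only [fun ω => (hA ω).pow_apply_self q m v]
  exact (((hbaby (m % q) (Nat.mod_lt m hq).le v).mono (h₂.le v)).prodMk
    (hgiant (m / q) (Nat.div_le_of_le_mul hm) v)).comp
      fun x => ∑ u, x.1 u * ((-1) ^ (q * (m / q)) * x.2 u)

end Powers

section Scenario

variable {n : ℕ} {F : Type} [Field F]

/-- The Tutte matrix of the input graph, with the seeds of node `v` as values of the variables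
`(v, w)`. -/
noncomputable def seededTutteMatrix (ω : SimpleGraph (Fin n) × (Fin n → Fin n → F)) :
    Matrix (Fin n) (Fin n) F :=
  tutteMatrix ω.1 fun p => ω.2 p.1 p.2

/-- The vertices that the powers of the seeded Tutte matrix suggest for `D(G)`. -/
def candidates (ω : SimpleGraph (Fin n) × (Fin n → Fin n → F)) : Set (Fin n) :=
  {v | ¬ IsStrictlyProper n fun m => (seededTutteMatrix ω ^ m) v v}

theorem exists_evolves_seededTutteMatrix [Fintype F] {B b : ℕ} (hB : 1 ≤ B)
    (hF : Fintype.card F ≤ 2 ^ b) :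
    ∃ K', Evolves B (4 * b)
      (initialKnowledge (Fin n → F) fun (G : SimpleGraph (Fin n)) v => G.neighborSet v) K' ∧
      ∀ v, Knows (K' v) fun ω => seededTutteMatrix ω v := by
  set K := initialKnowledge (Fin n → F) fun (G : SimpleGraph (Fin n)) v => G.neighborSet v
  have hinit : ∀ v, Knows (K v) fun ω => (ω.1.neighborSet v, ω.2 v) := fun v => knows_ker _
  obtain ⟨K', h, hseed⟩ := exists_evolves_exchange hB K hF (word := fun u v ω => ω.2 u v)
    fun u v => (hinit u).comp fun x => x.2 v
  refine ⟨K', h, fun v ω ω' hω => funext fun w => ?_⟩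
  have hadj : ω.1.Adj v w = ω'.1.Adj v w :=
    (hinit v).comp (fun x => w ∈ x.1) ω ω' (h.le v hω)
  have hown : ω.2 v w = ω'.2 v w := (hinit v).comp (fun x => x.2 w) ω ω' (h.le v hω)
  simp only [seededTutteMatrix, tutteMatrix, Matrix.of_apply, hown, hseed w v ω ω' hω]
  classical exact if_congr hadj.to_iff rfl rfl

theorem exists_evolves_decompositionOf_candidates [Fintype F] {B b q R : ℕ} (hB : 1 ≤ B)
    (hF : Fintype.card F ≤ 2 ^ b) (hq : 2 * n ≤ q * q) (hmul : CanMultiply n B F (q + 1) R) :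
    ∃ K', Evolves B (4 * b + 2 * (Nat.clog 2 q * R) + 8)
      (initialKnowledge (Fin n → F) fun (G : SimpleGraph (Fin n)) v => G.neighborSet v) K' ∧
      ∀ v, Knows (K' v) fun ω => decompositionOf ω.1 (candidates ω) := by
  obtain ⟨K₁, h₁, hmatrix⟩ := exists_evolves_seededTutteMatrix (n := n) hB hF
  obtain ⟨K₂, h₂, hpow⟩ := hmul.exists_evolves_pow_apply_self K₁
    (fun ω => isAlternating_tutteMatrix _) hmatrix
  have hcandidates : ∀ v, Knows (K₂ v) fun ω => v ∈ candidates ω := fun v ω ω' hω =>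
    propext (isStrictlyProper_congr fun m hm => hpow m (hm.trans hq) v ω ω' hω).not
  have hneighbors : ∀ v, Knows (K₂ v) fun ω => ω.1.neighborSet v := fun v =>
    ((knows_ker _).comp Prod.fst).mono ((h₁.trans h₂).le v)
  obtain ⟨K₃, h₃, hdecomposition⟩ := exists_evolves_decompositionOf hB K₂ hneighbors hcandidates
  exact ⟨K₃, (h₁.trans h₂).trans h₃, hdecomposition⟩

theorem card_decompositionOf_candidates_ne_le [Fintype F] (G : SimpleGraph (Fin n)) :
    Nat.card {r : Fin n → Fin n → F // ¬ decompositionOf G (candidates (G, r)) = G.gallaiEdmonds} *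
      Fintype.card F ≤ (n + 1) * n * Nat.card (Fin n → Fin n → F) := by
  have h := card_not_mem_gallaiEdmondsD_iff_le F G
  rw [Fintype.card_fin, Nat.card_congr (Equiv.curry (Fin n) (Fin n) F)] at h
  have hgood : ∀ r : Fin n → Fin n → F, (∀ v, v ∈ G.gallaiEdmondsD ↔
      ¬ IsStrictlyProper n fun m => (tutteMatrix G ((Equiv.curry _ _ _).symm r) ^ m) v v) →
      decompositionOf G (candidates (G, r)) = G.gallaiEdmonds := fun r hr =>
    (congrArg _ (Set.ext fun v => (hr v).symm)).trans (decompositionOf_gallaiEdmondsD G)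
  refine le_trans (Nat.mul_le_mul_right _ ?_) h
  exact Nat.card_le_card_of_injective
    (fun r => ⟨(Equiv.curry (Fin n) (Fin n) F).symm r.1, mt (hgood r.1) r.2⟩) fun r r' hr =>
      Subtype.ext ((Equiv.curry _ _ _).symm.injective (congrArg Subtype.val hr))

end Scenario

theorem one_sub_div_le_card_div_card {α : Type*} [Finite α] [Nonempty α] {p : α → Prop} {c N : ℕ}
    (hN : 0 < N) (h : Nat.card {a // ¬ p a} * N ≤ c * Nat.card α) :
    1 - (c : ℝ) / N ≤ (Nat.card {a // p a} : ℝ) / Nat.card α := by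
  classical
  have hsum : (Nat.card {a // p a} : ℝ) + Nat.card {a // ¬ p a} = Nat.card α := by
    rw [← Nat.card_congr (Equiv.sumCompl p), Nat.card_sum, Nat.cast_add]
  have hα : (0 : ℝ) < Nat.card α := by exact_mod_cast Nat.card_pos
  have hN' : (0 : ℝ) < N := by exact_mod_cast hN
  have hbad : (Nat.card {a // ¬ p a} : ℝ) / Nat.card α ≤ c / N := by
    rw [div_le_div_iff₀ hα hN']
    exact_mod_cast h
  rw [← eq_sub_iff_add_eq] at hsum
  rw [hsum, sub_div, div_self hα.ne']
  linarith

theorem CanMultiply.exists_protocol_gallaiEdmonds {n B : ℕ} {F : Type} [Field F] [Fintype F]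
    {b q R : ℕ} (hmul : CanMultiply n B F (q + 1) R) (hB : 1 ≤ B) (hF : Fintype.card F ≤ 2 ^ b)
    (hq : 2 * n ≤ q * q) :
    ∃ P : CliqueProtocol n B (Set (Fin n)) (Set (Fin n) × Set (Fin n) × Set (Fin n)),
      P.rounds = 4 * b + 2 * (Nat.clog 2 q * R) + 8 ∧
      ∀ G : SimpleGraph (Fin n), 1 - ((n + 1) * n : ℝ) / Fintype.card F ≤
        P.successProb (fun v => G.neighborSet v) fun out => ∀ v, out v = G.gallaiEdmonds := by
  obtain ⟨K, h, hout⟩ := exists_evolves_decompositionOf_candidates hB hF hq hmul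
  obtain ⟨P, hrounds, hprob⟩ := h.exists_protocol hout
  refine ⟨P, hrounds, fun G => ?_⟩
  rw [hprob]
  have hcard := one_sub_div_le_card_div_card Fintype.card_pos
    (card_decompositionOf_candidates_ne_le (F := F) G)
  push_cast at hcard
  refine hcard.trans (div_le_div_of_nonneg_right (Nat.cast_le.mpr ?_) (by positivity))
  exact Nat.card_le_card_of_injective _
    (Subtype.impEmbedding _ (fun r => ∀ v, decompositionOf G (candidates (G, r)) = _)
      fun r hr _ => hr).injective

/-! ### Choice of the parameters -/

section BlockSizes

theorem HasMatMulTensor.exists_rank_le_lt_mul {F : Type*} [Field F] {m₀ t₀ : ℕ}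
    (hT : HasMatMulTensor F m₀ t₀) (hm₀ : 2 ≤ m₀) {β : ℝ} (ht₀ : (t₀ : ℝ) ≤ (m₀ : ℝ) ^ β) {s : ℕ}
    (hs : 1 ≤ s) :
    ∃ m t, HasMatMulTensor F m t ∧ 1 ≤ m ∧ t ≤ s ∧ s < t * t₀ ∧ (t : ℝ) ≤ (m : ℝ) ^ β := by
  have ht₀' : 1 < t₀ := by nlinarith [hT.sq_le]
  refine ⟨m₀ ^ Nat.log t₀ s, t₀ ^ Nat.log t₀ s, hT.pow _, Nat.one_le_pow _ _ (by omega),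
    Nat.pow_log_le_self t₀ (by omega), Nat.lt_pow_succ_log_self ht₀' s, ?_⟩
  push_cast
  rw [← Real.rpow_pow_comm (Nat.cast_nonneg _)]
  exact pow_le_pow_left₀ (Nat.cast_nonneg _) ht₀ _

theorem HasMatMulTensor.canMultiply_of_rank_sq_le {F : Type*} [Field F] [Fintype F]
    {n B b m t s q a : ℕ} (hT : HasMatMulTensor F m t) (hB : 1 ≤ B) (hF : Fintype.card F ≤ 2 ^ b)
    (hn : 1 ≤ n) (hm : 1 ≤ m) (hts : t ≤ s) (hsn : s * s ≤ n) (hq : q ≤ a * s) :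
    CanMultiply n B F q (24 * ((4 * q + 4 * a * n / m ^ 2 + 2) * b)) := by
  set h := n / m + 1
  set c₁ := q * h ^ 2 / n + 1
  set e := 4 * a * n / m ^ 2
  have hmt : m ^ 2 ≤ t := hT.sq_le
  have htn : t ≤ n := by nlinarith
  have hmh : n ≤ m * h := (Nat.lt_mul_div_succ n hm).le
  have hmh' : m * h ≤ 2 * n := by
    rw [show m * h = m * (n / m) + m from Nat.mul_succ m _]
    nlinarith [Nat.mul_div_le n m]
  have hqt : q * t ≤ n * a := by nlinarith [Nat.mul_le_mul hq hts]
  have hc₁ : q * h ^ 2 < n * c₁ := Nat.lt_mul_div_succ _ hn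
  have hc₁' : n * c₁ ≤ q * h ^ 2 + n :=
    (Nat.mul_succ n _).trans_le (Nat.add_le_add_right (Nat.mul_div_le _ n) n)
  have hah : a * h ^ 2 ≤ (e + 1) * n := by
    have he : 4 * a * n < m ^ 2 * (e + 1) := Nat.lt_mul_div_succ _ (by positivity)
    refine Nat.le_of_mul_le_mul_left ?_ (show 0 < m ^ 2 by positivity)
    calc m ^ 2 * (a * h ^ 2) = a * (m * h) ^ 2 := by ring
      _ ≤ a * (2 * n) ^ 2 := by gcongr
      _ = 4 * a * n * n := by ring
      _ ≤ m ^ 2 * (e + 1) * n := by gcongr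
      _ = m ^ 2 * ((e + 1) * n) := by ring
  refine hT.canMultiply hB hF hmh hc₁.le hqt (by linarith) ?_ ?_ (by nlinarith)
  · refine Nat.le_of_mul_le_mul_left ?_ hn
    calc n * (c₁ * m ^ 2) ≤ (q * h ^ 2 + n) * m ^ 2 := by nlinarith
      _ = q * (m * h) ^ 2 + n * m ^ 2 := by ring
      _ ≤ q * (2 * n) ^ 2 + n * n := by gcongr; omega
      _ ≤ n * ((4 * q + e + 2) * n) := by nlinarith
  · refine Nat.le_of_mul_le_mul_left ?_ hn
    calc n * (c₁ * t) ≤ (q * h ^ 2 + n) * t := by nlinarith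
      _ = q * t * h ^ 2 + n * t := by ring
      _ ≤ n * a * h ^ 2 + n * n := by gcongr
      _ ≤ n * ((4 * q + e + 2) * n) := by nlinarith

theorem rpow_one_div_le_mul_sq {β x m t c : ℝ} (hβ : 2 ≤ β) (hx : 0 ≤ x) (hm : 0 ≤ m) (ht : 0 ≤ t)
    (hc : 1 ≤ c) (htm : t ≤ m ^ β) (hxt : x ≤ (c * t) ^ 2) : x ^ (1 / β) ≤ c * m ^ 2 := by
  rw [one_div, Real.rpow_inv_le_iff_of_pos hx (by positivity) (by linarith)]
  calc x ≤ c ^ 2 * t ^ 2 := by rwa [← mul_pow]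
    _ ≤ c ^ β * (m ^ β) ^ 2 := by
        gcongr
        rw [← Real.rpow_two]
        exact Real.rpow_le_rpow_of_exponent_le hc hβ
    _ = (c * m ^ 2) ^ β := by
        rw [Real.rpow_pow_comm hm, ← Real.mul_rpow (by positivity) (by positivity)]

theorem div_sq_le_mul_rpow {β x m t c : ℝ} (hβ : 2 ≤ β) (hx : 0 < x) (hm : 0 < m) (ht : 0 ≤ t)
    (hc : 1 ≤ c) (htm : t ≤ m ^ β) (hxt : x ≤ (c * t) ^ 2) :
    x / m ^ 2 ≤ c * x ^ (1 - 1 / β) := by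
  have hroot := rpow_one_div_le_mul_sq hβ hx.le hm.le ht hc htm hxt
  rw [div_le_iff₀ (by positivity)]
  calc x = x ^ (1 - 1 / β) * x ^ (1 / β) := by
        rw [← Real.rpow_add hx, sub_add_cancel, Real.rpow_one]
    _ ≤ x ^ (1 - 1 / β) * (c * m ^ 2) := by gcongr
    _ = c * x ^ (1 - 1 / β) * m ^ 2 := by ring

theorem natCast_sqrt_le_rpow {β : ℝ} (hβ : 2 ≤ β) {n : ℕ} (hn : 1 ≤ n) :
    (n.sqrt : ℝ) ≤ (n : ℝ) ^ (1 - 1 / β) := by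
  have hinv : 1 / β ≤ 1 / 2 := one_div_le_one_div_of_le (by norm_num) hβ
  calc (n.sqrt : ℝ) ≤ √n := Real.nat_sqrt_le_real_sqrt
    _ = (n : ℝ) ^ (1 / 2 : ℝ) := Real.sqrt_eq_rpow _
    _ ≤ (n : ℝ) ^ (1 - 1 / β) :=
        Real.rpow_le_rpow_of_exponent_le (by exact_mod_cast hn) (by linarith)

theorem HasMatMulTensor.exists_canMultiply_sqrt {F : Type*} [Field F] [Fintype F] {m₀ t₀ : ℕ}
    (hT : HasMatMulTensor F m₀ t₀) (hm₀ : 2 ≤ m₀) {β : ℝ} (hβ : 2 ≤ β)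
    (ht₀ : (t₀ : ℝ) ≤ (m₀ : ℝ) ^ β) {n B b : ℕ} (hB : 1 ≤ B) (hF : Fintype.card F ≤ 2 ^ b)
    (hn : 1 ≤ n) :
    ∃ R, CanMultiply n B F (2 * (n.sqrt + 1) + 1) R ∧
      (R : ℝ) ≤ 24 * ((22 + 40 * t₀) * (n : ℝ) ^ (1 - 1 / β) * b) := by
  have hs : 1 ≤ n.sqrt := Nat.sqrt_pos.mpr hn
  obtain ⟨m, t, hmt, hm, hts, hst, htm⟩ := hT.exists_rank_le_lt_mul hm₀ ht₀ hs
  refine ⟨_, hmt.canMultiply_of_rank_sq_le (a := 5) hB hF hn hm hts n.sqrt_le (by omega), ?_⟩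
  have hroot : n ≤ (2 * t₀ * t) ^ 2 := by
    have hsucc : n.sqrt + 1 ≤ 2 * t₀ * t := by nlinarith
    exact (Nat.lt_succ_sqrt' n).le.trans (Nat.pow_le_pow_left hsucc 2)
  have ht₀' : 1 ≤ t₀ := Nat.pos_of_ne_zero (by rintro rfl; simp at hst)
  have hblock : (n : ℝ) / m ^ 2 ≤ 2 * t₀ * (n : ℝ) ^ (1 - 1 / β) :=
    div_sq_le_mul_rpow hβ (by exact_mod_cast hn) (by exact_mod_cast hm) t.cast_nonneg
      (by exact_mod_cast (by omega : 1 ≤ 2 * t₀)) htm (by exact_mod_cast hroot)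
  have hquot : ((4 * 5 * n / m ^ 2 : ℕ) : ℝ) ≤ 20 * (n / m ^ 2) := by
    refine Nat.cast_div_le.trans_eq ?_
    push_cast
    ring
  have hsqrt := natCast_sqrt_le_rpow hβ hn
  have hs' : (1 : ℝ) ≤ n.sqrt := by exact_mod_cast hs
  push_cast
  gcongr
  push_cast at hquot
  linarith

end BlockSizes

section Prime

theorem exists_prime_intCast_ne_zero {D : ℤ} (hD : D ≠ 0) {N : ℕ} (hN : D.natAbs ≤ N) :
    ∃ p, p.Prime ∧ N < p ∧ p ≤ 2 * N ∧ (D : ZMod p) ≠ 0 := by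
  have hD' : 0 < D.natAbs := Int.natAbs_pos.mpr hD
  obtain ⟨p, hp, hNp, hpN⟩ := Nat.exists_prime_lt_and_le_two_mul N (by omega)
  refine ⟨p, hp, hNp, hpN, fun h => ?_⟩
  have hdvd : p ∣ D.natAbs := Int.natCast_dvd.mp ((ZMod.intCast_zmod_eq_zero_iff_dvd D p).mp h)
  exact absurd (Nat.le_of_dvd hD' hdvd) (by omega)

end Prime

section Exponents

theorem clog_two_le_mul_rpow {δ : ℝ} (hδ : 0 < δ) (x : ℕ) :
    (Nat.clog 2 x : ℝ) ≤ (1 + 1 / (δ * Real.log 2)) * (x : ℝ) ^ δ := by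
  rcases x.eq_zero_or_pos with rfl | hx
  · simp [Real.zero_rpow hδ.ne']
  have hx' : (1 : ℝ) ≤ x := by exact_mod_cast hx
  have hlog : Real.logb 2 x ≤ x ^ δ / δ / Real.log 2 := by
    rw [Real.logb]
    gcongr
    exact Real.log_le_rpow_div x.cast_nonneg hδ
  calc (Nat.clog 2 x : ℝ) = ⌈Real.logb 2 x⌉₊ := by rw [← Real.natCeil_logb_natCast, Nat.cast_ofNat]
    _ ≤ Real.logb 2 x + 1 := (Nat.ceil_lt_add_one (Real.logb_nonneg one_lt_two hx')).le
    _ ≤ x ^ δ / δ / Real.log 2 + x ^ δ := add_le_add hlog (Real.one_le_rpow hx' hδ.le)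
    _ = (1 + 1 / (δ * Real.log 2)) * x ^ δ := by ring

theorem exists_sq_clog_two_le_rpow {η : ℝ} (hη : 0 < η) (a : ℕ) {j : ℕ} (hj : 0 < j) :
    ∃ C : ℝ, 0 ≤ C ∧ ∀ n : ℕ, (Nat.clog 2 (a * n ^ j) : ℝ) ^ 2 ≤ C * (n : ℝ) ^ η := by
  have hδ : 0 < η / (2 * j) := by positivity
  refine ⟨((1 + 1 / (η / (2 * j) * Real.log 2)) * (a : ℝ) ^ (η / (2 * j))) ^ 2, by positivity,
    fun n => ?_⟩
  have hpow : (((n : ℝ) ^ j) ^ (η / (2 * j))) ^ 2 = (n : ℝ) ^ η := by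
    rw [← Real.rpow_natCast_mul n.cast_nonneg, ← Real.rpow_mul_natCast n.cast_nonneg]
    congr 1
    field_simp
    norm_num
  calc (Nat.clog 2 (a * n ^ j) : ℝ) ^ 2
      ≤ ((1 + 1 / (η / (2 * j) * Real.log 2)) * ((a * n ^ j : ℕ) : ℝ) ^ (η / (2 * j))) ^ 2 :=
        pow_le_pow_left₀ (Nat.cast_nonneg _) (clog_two_le_mul_rpow hδ _) 2
    _ = _ := by
        rw [Nat.cast_mul, Nat.cast_pow, Real.mul_rpow a.cast_nonneg (by positivity), ← mul_assoc,
          mul_pow, hpow]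

theorem one_sub_one_div_add_half_le {ω ε : ℝ} (hω : 2 ≤ ω) (hε : 0 ≤ ε) :
    1 - 1 / (ω + ε) + ε / 2 ≤ 1 - 1 / ω + ε := by
  have hdiff : 1 / ω - 1 / (ω + ε) ≤ ε / 2 := by
    rw [div_sub_div _ _ (by positivity) (by positivity), div_le_iff₀ (by positivity)]
    nlinarith [mul_nonneg hε (by nlinarith : 0 ≤ ω * (ω + ε) - 2)]
  linarith

end Exponents

section Protocols

theorem HasMatMulTensor.exists_protocol_gallaiEdmonds {F : Type} [Field F] [Fintype F] {m₀ t₀ : ℕ}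
    (hT : HasMatMulTensor F m₀ t₀) (hm₀ : 2 ≤ m₀) {β : ℝ} (hβ : 2 ≤ β)
    (ht₀ : (t₀ : ℝ) ≤ (m₀ : ℝ) ^ β) {n B b : ℕ} (hB : 1 ≤ B) (hF : Fintype.card F ≤ 2 ^ b)
    (hn : 1 ≤ n) (hnb : 4 * n ≤ 2 ^ b) :
    ∃ P : CliqueProtocol n B (Set (Fin n)) (Set (Fin n) × Set (Fin n) × Set (Fin n)),
      (P.rounds : ℝ) ≤ (1068 + 1920 * t₀) * ((n : ℝ) ^ (1 - 1 / β) * (b : ℝ) ^ 2) ∧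
      ∀ G : SimpleGraph (Fin n), 1 - ((n + 1) * n : ℝ) / Fintype.card F ≤
        P.successProb (fun v => G.neighborSet v) fun out => ∀ v, out v = G.gallaiEdmonds := by
  obtain ⟨R, hmul, hR⟩ := hT.exists_canMultiply_sqrt hm₀ hβ ht₀ hB hF hn
  obtain ⟨P, hrounds, hprob⟩ :=
    hmul.exists_protocol_gallaiEdmonds hB hF (by nlinarith [Nat.lt_succ_sqrt n])
  refine ⟨P, ?_, hprob⟩
  have hclog : Nat.clog 2 (2 * (n.sqrt + 1)) ≤ b :=
    Nat.clog_le_of_le_pow ((by have := n.sqrt_le_self; omega : _ ≤ 4 * n).trans hnb)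
  have hb : (1 : ℝ) ≤ b := by
    exact_mod_cast Nat.one_le_iff_ne_zero.mpr (by rintro rfl; omega)
  have hpow : 1 ≤ (n : ℝ) ^ (1 - 1 / β) := by
    refine Real.one_le_rpow (by exact_mod_cast hn) (sub_nonneg.mpr ?_)
    exact (div_le_one (by linarith)).mpr (by linarith)
  rw [hrounds]
  push_cast
  calc 4 * (b : ℝ) + 2 * (Nat.clog 2 (2 * (n.sqrt + 1)) * R) + 8
      ≤ 4 * b + 2 * (b * (24 * ((22 + 40 * t₀) * (n : ℝ) ^ (1 - 1 / β) * b))) + 8 := by gcongr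
    _ = 4 * b + 8 + (1056 + 1920 * t₀) * ((n : ℝ) ^ (1 - 1 / β) * b ^ 2) := by ring
    _ ≤ 12 * ((n : ℝ) ^ (1 - 1 / β) * b ^ 2) +
        (1056 + 1920 * t₀) * ((n : ℝ) ^ (1 - 1 / β) * b ^ 2) := by
      gcongr
      nlinarith
    _ = _ := by ring

theorem add_one_mul_div_le_one_div_pow {n N k p : ℕ} (hn : 1 ≤ n) (hN : 2 ≤ N)
    (hp : N * n ^ (k + 2) < p) : ((n + 1) * n : ℝ) / p ≤ 1 / (n : ℝ) ^ k := by
  have hp' : (0 : ℝ) < p := by exact_mod_cast hp.pos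
  rw [div_le_div_iff₀ hp' (by positivity), one_mul]
  have hle : (n + 1) * n * n ^ k ≤ p :=
    calc (n + 1) * n * n ^ k ≤ N * n * n * n ^ k := by gcongr; nlinarith
      _ = N * n ^ (k + 2) := by ring
      _ ≤ p := hp.le
  exact_mod_cast hle

theorem HasMatMulTensor.exists_protocol_gallaiEdmonds_rpow {m₀ t₀ : ℕ}
    (hT : HasMatMulTensor ℚ m₀ t₀) (hm₀ : 2 ≤ m₀) {β : ℝ} (hβ : 2 ≤ β)
    (ht₀ : (t₀ : ℝ) ≤ (m₀ : ℝ) ^ β) {η : ℝ} (hη : 0 < η) (k : ℕ) :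
    ∃ C : ℝ, 0 ≤ C ∧ ∀ n B : ℕ, 1 ≤ n → 1 ≤ B →
      ∃ P : CliqueProtocol n B (Set (Fin n)) (Set (Fin n) × Set (Fin n) × Set (Fin n)),
        (P.rounds : ℝ) ≤ C * (n : ℝ) ^ (1 - 1 / β + η) ∧
        ∀ G : SimpleGraph (Fin n), 1 - 1 / (n : ℝ) ^ k ≤
          P.successProb (fun v => G.neighborSet v) fun out => ∀ v, out v = G.gallaiEdmonds := by
  obtain ⟨D, hD, hTF⟩ := hT.exists_int_forall_field
  obtain ⟨N, hDN, hN⟩ : ∃ N, D.natAbs ≤ N ∧ 2 ≤ N := ⟨D.natAbs + 2, by omega, by omega⟩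
  obtain ⟨C, hC, hlog⟩ := exists_sq_clog_two_le_rpow hη (2 * N) (j := k + 2) (by omega)
  refine ⟨(1068 + 1920 * t₀) * C, by positivity, fun n B hn hB => ?_⟩
  set b := Nat.clog 2 (2 * N * n ^ (k + 2))
  have hb : 2 * N * n ^ (k + 2) ≤ 2 ^ b := Nat.le_pow_clog one_lt_two _
  have hpow : n ≤ n ^ (k + 2) := Nat.le_self_pow (by omega) n
  obtain ⟨p, hp, hlt, hle, hDp⟩ := exists_prime_intCast_ne_zero hD
    (hDN.trans (Nat.le_mul_of_pos_right N (hn.trans hpow)))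
  have : Fact p.Prime := ⟨hp⟩
  have hcard : Fintype.card (ZMod p) ≤ 2 ^ b := by
    rw [ZMod.card]
    exact hle.trans (by rwa [← mul_assoc])
  obtain ⟨P, hrounds, hprob⟩ := (hTF (ZMod p) hDp).exists_protocol_gallaiEdmonds hm₀ hβ ht₀ hB
    hcard hn (by nlinarith)
  refine ⟨P, hrounds.trans ?_, fun G => le_trans ?_ (hprob G)⟩
  · rw [Real.rpow_add (by exact_mod_cast hn)]
    calc (1068 + 1920 * t₀) * ((n : ℝ) ^ (1 - 1 / β) * (b : ℝ) ^ 2)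
        ≤ (1068 + 1920 * t₀) * ((n : ℝ) ^ (1 - 1 / β) * (C * (n : ℝ) ^ η)) := by
          gcongr
          exact hlog n
      _ = _ := by ring
  · rw [ZMod.card]
    exact sub_le_sub_left (add_one_mul_div_le_one_div_pow hn hN hlt) 1

theorem exists_protocol_rounds_eq_zero (n B : ℕ) (In Out : Type) [Inhabited Out] :
    ∃ P : CliqueProtocol n B In Out, P.rounds = 0 := by
  have h : Evolves B 0 (initialKnowledge Unit fun x : Fin n → In => x) _ := Evolves.refl _
  obtain ⟨P, hP, -⟩ := h.exists_protocol fun _ => Knows.const (default : Out)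
  exact ⟨P, hP⟩

end Protocols

/-- Messages have `c * ⌈log₂ n⌉` bits, the input of node `v` is its set of neighbours, and with
probability at least `1 - n ^ (-k)` every node outputs the whole decomposition. -/
theorem theorem8 (ε : ℝ) (hε : 0 < ε) (c : ℕ) (hc : 1 ≤ c) (k : ℕ) :
    ∃ C : ℝ, ∀ n : ℕ, 1 ≤ n →
      ∃ P : CliqueProtocol n (c * Nat.clog 2 n) (Set (Fin n))
          (Set (Fin n) × Set (Fin n) × Set (Fin n)),
        (P.rounds : ℝ) ≤ C * (n : ℝ) ^ (1 - 1 / matMulExponent ℚ + ε) ∧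
        ∀ G : SimpleGraph (Fin n),
          1 - 1 / (n : ℝ) ^ k ≤
            P.successProb (fun v => G.neighborSet v)
              (fun out => ∀ v : Fin n, out v = G.gallaiEdmonds) := by
  obtain ⟨m₀, t₀, hm₀, hT, ht₀⟩ := exists_hasMatMulTensor_rank_le ℚ hε
  have hω : 2 ≤ matMulExponent ℚ := two_le_matMulExponent ℚ
  obtain ⟨C, hC, h⟩ :=
    hT.exists_protocol_gallaiEdmonds_rpow hm₀ (by linarith) ht₀ (half_pos hε) k
  refine ⟨C, fun n hn => ?_⟩
  rcases hn.eq_or_lt with rfl | hn'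
  · obtain ⟨P, hP⟩ := exists_protocol_rounds_eq_zero 1 (c * Nat.clog 2 1) (Set (Fin 1))
      (Set (Fin 1) × Set (Fin 1) × Set (Fin 1))
    refine ⟨P, by rw [hP, Nat.cast_zero]; positivity, fun G => ?_⟩
    rw [Nat.cast_one, one_pow, div_one, sub_self]
    exact div_nonneg (Nat.cast_nonneg _) (Nat.cast_nonneg _)
  · obtain ⟨P, hrounds, hprob⟩ := h n _ hn (Nat.mul_pos hc (Nat.clog_pos one_lt_two hn'))
    refine ⟨P, hrounds.trans (mul_le_mul_of_nonneg_left ?_ hC), hprob⟩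
    exact Real.rpow_le_rpow_of_exponent_le (by exact_mod_cast hn)
      (one_sub_one_div_add_half_le hω hε.le)
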